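/- Let $N\ge 0$ be an integer and let $\mathcal V\subset\mathbb R^N$ be a finite set with $\operatorname{span}(\mathcal V)=\mathbb R^N$. Let $\|x\|=\max_{v\in\mathcal V}|\langle x,v\rangle|$ be the associated crystalline norm (with $\|x\|=0$ if $N=0$ and $\mathcal V=\emptyset$) and let $\mathsf d(x,y)=\|x-y\|$. Let $\mathsf d_{eu}$ denote the Euclidean distance, $\mathscr L^N$ the Lebesgue measure on $\mathbb R^N$, and $\mathscr P_2(\mathbb R^N)$ the set of Borel probability measures on $\mathbb R^N$ with finite second moment. For $\mu,\nu\in\mathscr P_2(\mathbb R^N)$ let $\Gamma(\mu,\nu)$ be the set of Borel probability measures on $\mathbb R^N\times\mathbb R^N$ with first marginal $\mu$ and second marginal $\nu$. Let $\Pi_1(\mu,\nu)$ be the set of minimizers of $\pi\mapsto\int \mathsf d^2(x,y)\,d\pi(x,y)$ over $\pi\in\Gamma(\mu,\nu)$, and let $\Pi_2(\mu,\nu)$ be the set of minimizers of the secondary variational problem $$\min_{\pi\in\Pi_1(\mu,\nu)}\int \mathsf d_{eu}^2(x,y)\,d\pi(x,y).$$ Theorem. If $\mu,\nu\in\mathscr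 P_2(\mathbb R^N)$ and $\mu\ll\mathscr L^N$, then $\Pi_2(\mu,\nu)$ consists of exactly one element $\pi$, and $\pi$ is induced by a map: there is a $\mu$-measurable map $T:\mathbb R^N\to\mathbb R^N$ such that $\pi=(\mathrm{id},T)_\#\mu$. -/

import Mathlib

open MeasureTheory
open scoped ENNReal

noncomputable section

/-- `EuclideanSpace ℝ (Fin N)`, i.e. `ℝ^N` with its Euclidean inner product, Euclidean distance,
Borel σ-algebra and Lebesgue measure. -/
abbrev RN (N : ℕ) : Type := EuclideanSpace ℝ (Fin N)

/-- The crystalline norm `‖x‖ = max_{v ∈ V} |⟨x, v⟩|` of a finite set `V ⊂ ℝ^N`. The supremum is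
over a finite type, hence a maximum; for `V = ∅` (which spans only when `N = 0`) its value is `0`. -/
def crystallineNorm {N : ℕ} (V : Finset (RN N)) (x : RN N) : ℝ :=
  ⨆ v : V, |inner ℝ x (v : RN N)|

/-- The crystalline distance `d(x, y) = ‖x - y‖`. -/
def crystallineDist {N : ℕ} (V : Finset (RN N)) (x y : RN N) : ℝ :=
  crystallineNorm V (x - y)

/-- `μ ∈ 𝒫₂`: a Borel probability measure on `ℝ^N` with finite second moment
about one (equivalently, every) point. -/
def IsP2 {N : ℕ} (μ : Measure (RN N)) : Prop :=
  IsProbabilityMeasure μ ∧ ∃ x₀ : RN N, ∫⁻ x, ENNReal.ofReal (dist x x₀ ^ 2) ∂μ < ∞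

/-- The set `Γ(μ, ν)` of transport plans from `μ` to `ν`. -/
def transportPlans {X Y : Type*} [MeasurableSpace X] [MeasurableSpace Y]
    (μ : Measure X) (ν : Measure Y) : Set (Measure (X × Y)) :=
  {π | IsProbabilityMeasure π ∧ π.map Prod.fst = μ ∧ π.map Prod.snd = ν}

/-- The total cost `∫ c(x, y) dπ(x, y) ∈ [0, ∞]` of `π` for a nonnegative cost `c`. -/
def transportCost {X Y : Type*} [MeasurableSpace X] [MeasurableSpace Y]
    (c : X → Y → ℝ) (π : Measure (X × Y)) : ℝ≥0∞ :=
  ∫⁻ p, ENNReal.ofReal (c p.1 p.2) ∂π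

/-- The elements of `S` that minimize the total cost for `c` among all elements of `S`. -/
def costMinimizers {X Y : Type*} [MeasurableSpace X] [MeasurableSpace Y]
    (c : X → Y → ℝ) (S : Set (Measure (X × Y))) : Set (Measure (X × Y)) :=
  {π | π ∈ S ∧ ∀ η ∈ S, transportCost c π ≤ transportCost c η}

/-- `Π₁(μ, ν)`: the optimal plans for the squared crystalline distance. -/
def primaryMinimizers {N : ℕ} (V : Finset (RN N)) (μ ν : Measure (RN N)) :
    Set (Measure (RN N × RN N)) :=
  costMinimizers (fun x y => crystallineDist V x y ^ 2) (transportPlans μ ν)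

/-- `Π₂(μ, ν)`: the minimizers of the squared Euclidean distance cost among `Π₁(μ, ν)`. -/
def secondaryMinimizers {N : ℕ} (V : Finset (RN N)) (μ ν : Measure (RN N)) :
    Set (Measure (RN N × RN N)) :=
  costMinimizers (fun x y => dist x y ^ 2) (primaryMinimizers V μ ν)

/-- `π` is induced by a map: `π = (id, T)_# μ` for some `μ`-measurable map `T`. -/
def IsInducedByMap {X Y : Type*} [MeasurableSpace X] [MeasurableSpace Y]
    (μ : Measure X) (π : Measure (X × Y)) : Prop :=
  ∃ T : X → Y, AEMeasurable T μ ∧ π = μ.map (fun x => (x, T x))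

end

open scoped ProbabilityTheory
open Filter Topology

/-! The engine is a crossing inequality. If two distinct segments `x → y` and `x' → y'` meet at the
same time `t ∈ (0,1)`, exchanging their targets does not increase the squared crystalline cost (the
new displacements are convex combinations of the old ones) and strictly decreases the squared
Euclidean cost. Hence disjoint pieces of a secondary minimizer have mutually singular time-`t`
interpolations (`mutuallySingular_map_interp`).

If the target is finitely supported, each target contributes a homothetic image of part of the
source, with density at most `M (1 - t)⁻ᴺ`. By singularity these bounds do not accumulate, so they
survive limits: first in the approximation of the target, for the cost `c₁ + ε c₂`, then as `ε → 0`.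
This yields some, not yet every, secondary minimizer with the bound
(`exists_interpBounded_secondary_minimizer`).

Suppose now that a secondary minimizer sends a common part of the source into two disjoint target
sets. Inside it lie two subplans starting from a uniform measure on a compact set `A`; replacing
them by minimizers with the density bound keeps the whole optimal (`replace_mem_costMinimizers`).
Their interpolations are mutually singular with density close to `1/|A|`, yet as `t → 0` both unit
masses lie in a shrinking neighbourhood of `A`, which has room for only one
(`not_forall_mutuallySingular_interp`). So every secondary minimizer lies on a graph. The average of
two minimizers is again one, so both lie on one graph and coincide. -/

/-! ### Mutually singular measures, submeasures and partial couplings. -/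

lemma exists_common_part {α : Type*} [MeasurableSpace α] {m₁ m₂ : Measure α}
    [IsFiniteMeasure m₁] [IsFiniteMeasure m₂] (h : ¬ m₁ ⟂ₘ m₂) :
    ∃ m : Measure α, m ≠ 0 ∧ m ≤ m₁ ∧ m ≤ m₂ := by
  rw [Measure.mutuallySingular_iff_disjoint, Disjoint] at h
  push Not at h
  obtain ⟨m, h1, h2, h3⟩ := h
  exact ⟨m, fun h0 => h3 (by rw [h0]; exact bot_le), h1, h2⟩

/-- Each measure lives on its own side of a separating set, so on each side only one of the two
bounds is spent. This is what prevents density bounds from adding up. -/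
lemma add_le_of_mutuallySingular {α : Type*} [MeasurableSpace α] {m₁ m₂ L : Measure α}
    (h : m₁ ⟂ₘ m₂) (h₁ : m₁ ≤ L) (h₂ : m₂ ≤ L) : m₁ + m₂ ≤ L := by
  obtain ⟨s, hs, h1, h2⟩ := h
  refine Measure.le_iff.2 fun t ht => ?_
  rw [Measure.add_apply, ← measure_inter_add_sdiff (μ := m₁) t hs,
    ← measure_inter_add_sdiff (μ := m₂) t hs, ← measure_inter_add_sdiff (μ := L) t hs,
    measure_mono_null Set.inter_subset_right h1,
    measure_mono_null (s := t \ s) (fun x hx => hx.2) h2, zero_add, add_zero, add_comm]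
  exact add_le_add (h₂ _) (h₁ _)

lemma finset_sum_le_of_mutuallySingular {α ι : Type*} [MeasurableSpace α] {m : ι → Measure α}
    {L : Measure α} (F : Finset ι) (h : ∀ i ∈ F, ∀ j ∈ F, i ≠ j → m i ⟂ₘ m j)
    (hL : ∀ i ∈ F, m i ≤ L) : ∑ i ∈ F, m i ≤ L := by
  classical
  induction F using Finset.induction_on with
  | empty => simpa using Measure.zero_le L
  | insert a F ha ih =>
    rw [Finset.sum_insert ha]
    refine add_le_of_mutuallySingular ?_ (hL a (by simp)) (ih ?_ ?_)
    · have : ∀ G ⊆ F, m a ⟂ₘ ∑ i ∈ G, m i := by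
        intro G
        induction G using Finset.induction_on with
        | empty => intro _; simp
        | insert b G hb ihG =>
          intro hG
          rw [Finset.sum_insert hb]
          have hbF : b ∈ F := hG (by simp)
          refine Measure.MutuallySingular.add_right ?_ (ihG fun x hx => hG (by simp [hx]))
          exact h a (by simp) b (by simp [hbF]) (fun e => ha (e ▸ hbF))
      exact this F subset_rfl
    · exact fun i hi j hj => h i (by simp [hi]) j (by simp [hj])
    · exact fun i hi => hL i (by simp [hi])

lemma compProd_le_compProd_left {α β : Type*} [MeasurableSpace α] [MeasurableSpace β]
    {m₁ m₂ : Measure α} [SFinite m₁] [SFinite m₂] (h : m₁ ≤ m₂)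
    (κ : ProbabilityTheory.Kernel α β) [ProbabilityTheory.IsSFiniteKernel κ] :
    m₁ ⊗ₘ κ ≤ m₂ ⊗ₘ κ := by
  refine Measure.le_iff.2 fun s hs => ?_
  rw [Measure.compProd_apply hs, Measure.compProd_apply hs]
  exact lintegral_mono' h le_rfl

/-- A measure below the first marginal of `ρ` is the first marginal of a measure below `ρ`. -/
lemma exists_le_fst_eq {α β : Type*} [MeasurableSpace α] [MeasurableSpace β] [StandardBorelSpace β]
    [Nonempty β] (ρ : Measure (α × β)) [IsFiniteMeasure ρ] {m : Measure α} [IsFiniteMeasure m]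
    (h : m ≤ ρ.fst) : ∃ ρ' : Measure (α × β), ρ' ≤ ρ ∧ ρ'.fst = m := by
  refine ⟨m ⊗ₘ ρ.condKernel, ?_, Measure.fst_compProd _ _⟩
  calc m ⊗ₘ ρ.condKernel ≤ ρ.fst ⊗ₘ ρ.condKernel := compProd_le_compProd_left h _
    _ = ρ := ρ.disintegrate _

/-- Two measures whose images under `f` have a common part `m` admit a partial coupling of mass
`m univ` that is concentrated on pairs with the same image. -/
lemma exists_coupling_of_le_map {P Z : Type*} [MeasurableSpace P] [StandardBorelSpace P]
    [Nonempty P] [MeasurableSpace Z] [MeasurableEq Z] (ρ₁ ρ₂ : Measure P) [IsFiniteMeasure ρ₁]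
    [IsFiniteMeasure ρ₂] {f : P → Z} (hf : Measurable f) {m : Measure Z}
    (h₁ : m ≤ ρ₁.map f) (h₂ : m ≤ ρ₂.map f) :
    ∃ σ : Measure (P × P), σ.fst ≤ ρ₁ ∧ σ.snd ≤ ρ₂ ∧ σ Set.univ = m Set.univ ∧
      ∀ᵐ q ∂σ, f q.1 = f q.2 := by
  have : IsFiniteMeasure m := isFiniteMeasure_of_le _ h₁
  have key : ∀ (ρ : Measure P) [IsFiniteMeasure ρ], m ≤ ρ.map f →
      ∃ κ : ProbabilityTheory.Kernel Z P, ProbabilityTheory.IsMarkovKernel κ ∧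
        (m ⊗ₘ κ).snd ≤ ρ ∧ ∀ᵐ z ∂m, ∀ᵐ p ∂κ z, f p = z := by
    intro ρ _ hm
    have hg : Measurable fun p => (f p, p) := hf.prodMk measurable_id
    -- Disintegrating the law of `(f p, p)` over its first coordinate gives conditional laws on the
    -- fibres of `f`.
    set γ := ρ.map fun p => (f p, p) with hR
    have hfst : γ.fst = ρ.map f := by
      rw [Measure.fst, hR, Measure.map_map measurable_fst hg]; rfl
    have hsnd : γ.snd = ρ := by
      rw [Measure.snd, hR, Measure.map_map measurable_snd hg]; exact Measure.map_id
    have hle : m ⊗ₘ γ.condKernel ≤ γ := by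
      calc m ⊗ₘ γ.condKernel ≤ γ.fst ⊗ₘ γ.condKernel :=
            compProd_le_compProd_left (by rwa [hfst]) _
        _ = γ := γ.disintegrate _
    refine ⟨γ.condKernel, inferInstance, ?_, ?_⟩
    · refine (Measure.map_mono hle measurable_snd).trans ?_
      exact hsnd.le
    · have hs : MeasurableSet {q : Z × P | f q.2 = q.1} :=
        measurableSet_eq_fun (hf.comp measurable_snd) measurable_fst
      have hae : ∀ᵐ q ∂γ, f q.2 = q.1 := by
        rw [hR, ae_map_iff hg.aemeasurable hs]; simp
      have := (Measure.absolutelyContinuous_of_le hle).ae_le hae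
      exact Measure.ae_ae_of_ae_compProd this
  obtain ⟨κ₁, _, hκ₁, hκ₁'⟩ := key ρ₁ h₁
  obtain ⟨κ₂, _, hκ₂, hκ₂'⟩ := key ρ₂ h₂
  have e₁ : (κ₁ ×ₖ κ₂).fst = κ₁ := by ext; simp
  have e₂ : (κ₁ ×ₖ κ₂).snd = κ₂ := by ext; simp
  -- Draw `z` from `m`, then two independent points from the two conditional laws on the fibre over
  -- `z`.
  refine ⟨(m ⊗ₘ (κ₁ ×ₖ κ₂)).snd, ?_, ?_, ?_, ?_⟩
  · refine le_trans (le_of_eq ?_) hκ₁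
    rw [Measure.snd_compProd, Measure.snd_compProd, Measure.fst, Measure.map_comp _ _ measurable_fst,
      ← ProbabilityTheory.Kernel.fst_eq, e₁]
  · refine le_trans (le_of_eq ?_) hκ₂
    rw [Measure.snd_compProd, Measure.snd_compProd, Measure.snd, Measure.map_comp _ _ measurable_snd,
      ← ProbabilityTheory.Kernel.snd_eq, e₂]
  · rw [Measure.snd_univ]; simp [Measure.compProd_apply]
  · have hs : MeasurableSet {q : P × P | f q.1 = f q.2} :=
      measurableSet_eq_fun (hf.comp measurable_fst) (hf.comp measurable_snd)
    rw [Measure.snd, ae_map_iff measurable_snd.aemeasurable hs,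
      Measure.ae_compProd_iff (p := fun q : Z × P × P => f q.2.1 = f q.2.2) (measurable_snd hs)]
    filter_upwards [hκ₁', hκ₂'] with z hz₁ hz₂
    rw [ProbabilityTheory.Kernel.prod_apply]
    filter_upwards [(Measure.quasiMeasurePreserving_fst (μ := κ₁ z) (ν := κ₂ z)).ae hz₁,
      (Measure.quasiMeasurePreserving_snd (μ := κ₁ z) (ν := κ₂ z)).ae hz₂] with q h1 h2
    rw [h1, h2]

/-! ### Transport costs and exchange of targets. -/

section Cost
variable {X Y : Type*} [MeasurableSpace X] [MeasurableSpace Y]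

lemma transportCost_add (c : X → Y → ℝ) (π η : Measure (X × Y)) :
    transportCost c (π + η) = transportCost c π + transportCost c η :=
  lintegral_add_measure _ _ _

lemma transportCost_smul (c : X → Y → ℝ) (a : ℝ≥0∞) (π : Measure (X × Y)) :
    transportCost c (a • π) = a * transportCost c π :=
  lintegral_smul_measure _ _

lemma transportCost_mono (c : X → Y → ℝ) {π η : Measure (X × Y)} (h : π ≤ η) :
    transportCost c π ≤ transportCost c η :=
  lintegral_mono' h le_rfl

/-- Exchanging targets along a partial coupling `σ` of a plan with itself gives a plan. -/
lemma swap_mem_transportPlans {μ : Measure X} {ν : Measure Y} {r : Measure (X × Y)}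
    {σ : Measure ((X × Y) × (X × Y))} (h : r + (σ.fst + σ.snd) ∈ transportPlans μ ν) :
    r + (σ.map (fun q => (q.1.1, q.2.2)) + σ.map (fun q => (q.2.1, q.1.2)))
      ∈ transportPlans μ ν := by
  have m₁ : Measurable fun q : (X × Y) × (X × Y) => (q.1.1, q.2.2) := by fun_prop
  have m₂ : Measurable fun q : (X × Y) × (X × Y) => (q.2.1, q.1.2) := by fun_prop
  obtain ⟨hp, hμ, hν⟩ := h
  simp only [Measure.fst, Measure.snd, Measure.map_add _ _ measurable_fst,
    Measure.map_add _ _ measurable_snd, Measure.map_map measurable_fst measurable_fst,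
    Measure.map_map measurable_snd measurable_fst, Measure.map_map measurable_fst measurable_snd,
    Measure.map_map measurable_snd measurable_snd] at hμ hν
  have hμ' : (r + (σ.map (fun q => (q.1.1, q.2.2)) + σ.map (fun q => (q.2.1, q.1.2)))).map
      Prod.fst = μ := by
    rw [Measure.map_add _ _ measurable_fst, Measure.map_add _ _ measurable_fst,
      Measure.map_map measurable_fst m₁, Measure.map_map measurable_fst m₂]
    exact hμ
  refine ⟨⟨?_⟩, hμ', ?_⟩
  · rw [← Set.preimage_univ (f := Prod.fst), ← Measure.map_apply measurable_fst .univ, hμ', ← hμ]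
    have := hp.measure_univ
    simpa [Measure.map_apply measurable_fst .univ, Measure.fst, Measure.snd, Measure.map_apply,
      measurable_fst, measurable_snd, measurable_fst.comp measurable_fst,
      measurable_fst.comp measurable_snd] using this
  · rw [Measure.map_add _ _ measurable_snd, Measure.map_add _ _ measurable_snd,
      Measure.map_map measurable_snd m₁, Measure.map_map measurable_snd m₂,
      add_comm (σ.map _) (σ.map _)]
    exact hν

lemma transportCost_fst_add_snd {c : X → Y → ℝ} (hc : Measurable (Function.uncurry c))
    (σ : Measure ((X × Y) × (X × Y))) :
    transportCost c (σ.fst + σ.snd) =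
      ∫⁻ q, (ENNReal.ofReal (c q.1.1 q.1.2) + ENNReal.ofReal (c q.2.1 q.2.2)) ∂σ := by
  have hm : Measurable fun p : X × Y => ENNReal.ofReal (c p.1 p.2) := hc.ennreal_ofReal
  rw [transportCost_add, transportCost, transportCost, Measure.fst, Measure.snd,
    lintegral_map hm measurable_fst, lintegral_map hm measurable_snd, lintegral_add_left]
  exact hm.comp measurable_fst

lemma transportCost_swap {c : X → Y → ℝ} (hc : Measurable (Function.uncurry c))
    (σ : Measure ((X × Y) × (X × Y))) :
    transportCost c (σ.map (fun q => (q.1.1, q.2.2)) + σ.map (fun q => (q.2.1, q.1.2))) =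
      ∫⁻ q, (ENNReal.ofReal (c q.1.1 q.2.2) + ENNReal.ofReal (c q.2.1 q.1.2)) ∂σ := by
  have hm : Measurable fun p : X × Y => ENNReal.ofReal (c p.1 p.2) := hc.ennreal_ofReal
  rw [transportCost_add, transportCost, transportCost, lintegral_map hm (by fun_prop),
    lintegral_map hm (by fun_prop), lintegral_add_left]
  exact hm.comp (by fun_prop : Measurable fun q : (X × Y) × (X × Y) => (q.1.1, q.2.2))

/-- Lexicographic two-point monotonicity of lexicographically optimal plans, in integrated form. -/
lemma eq_zero_of_swap_improves {μ : Measure X} {ν : Measure Y} {c₁ c₂ : X → Y → ℝ}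
    (hc₁ : Measurable (Function.uncurry c₁)) (hc₂ : Measurable (Function.uncurry c₂))
    (h₁ : ∀ x y, 0 ≤ c₁ x y) (h₂ : ∀ x y, 0 ≤ c₂ x y) {π : Measure (X × Y)}
    (hπ : π ∈ costMinimizers c₂ (costMinimizers c₁ (transportPlans μ ν)))
    (hfin : transportCost c₂ π ≠ ∞) {σ : Measure ((X × Y) × (X × Y))}
    (hσ : σ.fst + σ.snd ≤ π)
    (himp : ∀ᵐ q ∂σ, c₁ q.1.1 q.2.2 + c₁ q.2.1 q.1.2 ≤ c₁ q.1.1 q.1.2 + c₁ q.2.1 q.2.2 ∧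
      c₂ q.1.1 q.2.2 + c₂ q.2.1 q.1.2 < c₂ q.1.1 q.1.2 + c₂ q.2.1 q.2.2) : σ = 0 := by
  have : IsProbabilityMeasure π := hπ.1.1.1
  have hfs : IsFiniteMeasure (σ.fst + σ.snd) := isFiniteMeasure_of_le _ hσ
  set r := π - (σ.fst + σ.snd) with hr
  have hπr : r + (σ.fst + σ.snd) = π := Measure.sub_add_cancel_of_le hσ
  set π' := r + (σ.map (fun q => (q.1.1, q.2.2)) + σ.map (fun q => (q.2.1, q.1.2))) with hπ'
  have hplan : π' ∈ transportPlans μ ν := by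
    refine swap_mem_transportPlans ?_
    rw [hπr]; exact hπ.1.1
  have hcost₁ : transportCost c₁ π' ≤ transportCost c₁ π := by
    rw [← hπr, hπ', transportCost_add _ r, transportCost_add _ r, transportCost_swap hc₁,
      transportCost_fst_add_snd hc₁]
    refine add_le_add le_rfl (lintegral_mono_ae ?_)
    filter_upwards [himp] with q hq
    rw [← ENNReal.ofReal_add (h₁ _ _) (h₁ _ _), ← ENNReal.ofReal_add (h₁ _ _) (h₁ _ _)]
    exact ENNReal.ofReal_le_ofReal hq.1
  have hmem : π' ∈ costMinimizers c₁ (transportPlans μ ν) :=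
    ⟨hplan, fun η hη => hcost₁.trans (hπ.1.2 η hη)⟩
  have hcost₂ := hπ.2 π' hmem
  by_contra hne
  refine hcost₂.not_gt ?_
  -- Finiteness of the `c₂`-cost allows the untouched remainder `r` to be cancelled and keeps the
  -- strict inequality strict after integration.
  have hfin' := hfin
  rw [← hπr, transportCost_add] at hfin'
  have hr_fin := (ENNReal.add_ne_top.1 hfin').1
  have hs_fin := (ENNReal.add_ne_top.1 hfin').2
  rw [transportCost_fst_add_snd hc₂] at hs_fin
  rw [← hπr, hπ', transportCost_add _ r, transportCost_add _ r, transportCost_swap hc₂,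
      transportCost_fst_add_snd hc₂]
  have hlt : ∀ᵐ q ∂σ, ENNReal.ofReal (c₂ q.1.1 q.2.2) + ENNReal.ofReal (c₂ q.2.1 q.1.2) <
      ENNReal.ofReal (c₂ q.1.1 q.1.2) + ENNReal.ofReal (c₂ q.2.1 q.2.2) := by
    filter_upwards [himp] with q hq
    rw [← ENNReal.ofReal_add (h₂ _ _) (h₂ _ _), ← ENNReal.ofReal_add (h₂ _ _) (h₂ _ _)]
    exact (ENNReal.ofReal_lt_ofReal_iff
      (lt_of_le_of_lt (add_nonneg (h₂ _ _) (h₂ _ _)) hq.2)).2 hq.2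
  refine (ENNReal.add_lt_add_iff_left hr_fin).2 (lintegral_strict_mono hne ?_ ?_ hlt)
  · have hm : Measurable fun p : X × Y => ENNReal.ofReal (c₂ p.1 p.2) := hc₂.ennreal_ofReal
    exact ((hm.comp measurable_fst).add (hm.comp measurable_snd)).aemeasurable
  · exact ((lintegral_mono_ae (hlt.mono fun q hq => hq.le)).trans_lt hs_fin.lt_top).ne

end Cost

/-! ### Interpolations and crossings. -/

/-- The point at time `t` of the segment from `p.1` to `p.2`. -/
noncomputable def interp {E : Type*} [AddCommGroup E] [Module ℝ E] (t : ℝ) (p : E × E) : E :=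
  (1 - t) • p.1 + t • p.2

/-- Exchanging the targets of two distinct segments that cross at the same interior time does not
increase the cost `c₁` and decreases the cost `c₂`. -/
def CrossingImproves {E : Type*} [AddCommGroup E] [Module ℝ E] (c₁ c₂ : E → E → ℝ) : Prop :=
  ∀ t : ℝ, 0 < t → t < 1 → ∀ p q : E × E, interp t p = interp t q → p ≠ q →
    c₁ p.1 q.2 + c₁ q.1 p.2 ≤ c₁ p.1 p.2 + c₁ q.1 q.2 ∧
      c₂ p.1 q.2 + c₂ q.1 p.2 < c₂ p.1 p.2 + c₂ q.1 q.2

section Crossing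
variable {E : Type*} [NormedAddCommGroup E] [NormedSpace ℝ E]

lemma continuous_interp (t : ℝ) : Continuous (interp t : E × E → E) := by
  unfold interp; fun_prop

variable [MeasurableSpace E] [BorelSpace E] [SecondCountableTopology E]

lemma measurable_interp (t : ℝ) : Measurable (interp t : E × E → E) :=
  (continuous_interp t).measurable

lemma restrict_add_restrict_le_of_disjoint {α : Type*} [MeasurableSpace α] (π : Measure α)
    {S₁ S₂ : Set α} (hS₂ : MeasurableSet S₂) (h : Disjoint S₁ S₂) :
    π.restrict S₁ + π.restrict S₂ ≤ π := by
  rw [← Measure.restrict_union h hS₂]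
  exact Measure.restrict_le_self

/-- Disjoint pieces of an optimal plan have mutually singular interpolations. -/
lemma mutuallySingular_map_interp [CompleteSpace E] {μ ν : Measure E} {c₁ c₂ : E → E → ℝ}
    (hc₁ : Measurable (Function.uncurry c₁)) (hc₂ : Measurable (Function.uncurry c₂))
    (h₁ : ∀ x y, 0 ≤ c₁ x y) (h₂ : ∀ x y, 0 ≤ c₂ x y) (hcross : CrossingImproves c₁ c₂)
    {π : Measure (E × E)}
    (hπ : π ∈ costMinimizers c₂ (costMinimizers c₁ (transportPlans μ ν)))
    (hfin : transportCost c₂ π ≠ ∞) {S₁ S₂ : Set (E × E)} (hS₁ : MeasurableSet S₁)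
    (hS₂ : MeasurableSet S₂) (hd : Disjoint S₁ S₂) {t : ℝ} (ht0 : 0 < t) (ht1 : t < 1) :
    (π.restrict S₁).map (interp t) ⟂ₘ (π.restrict S₂).map (interp t) := by
  have : IsProbabilityMeasure π := hπ.1.1.1
  by_contra hns
  obtain ⟨m, hm0, hm₁, hm₂⟩ := exists_common_part hns
  obtain ⟨σ, hσ₁, hσ₂, hσm, hσt⟩ :=
    exists_coupling_of_le_map (π.restrict S₁) (π.restrict S₂) (measurable_interp t) hm₁ hm₂
  have hle : σ.fst + σ.snd ≤ π :=
    (add_le_add hσ₁ hσ₂).trans (restrict_add_restrict_le_of_disjoint π hS₂ hd)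
  -- `σ` pairs points of the two pieces that meet at time `t`. Exchanging targets along it would
  -- improve the plan, so it carries no mass, although its mass is that of `m ≠ 0`.
  have hσ0 : σ = 0 := by
    refine eq_zero_of_swap_improves hc₁ hc₂ h₁ h₂ hπ hfin hle ?_
    have a₁ : ∀ᵐ q ∂σ, q.1 ∈ S₁ := by
      refine ae_of_ae_map (f := Prod.fst) (p := fun p => p ∈ S₁) measurable_fst.aemeasurable ?_
      exact (Measure.absolutelyContinuous_of_le hσ₁).ae_le (ae_restrict_mem hS₁)
    have a₂ : ∀ᵐ q ∂σ, q.2 ∈ S₂ := by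
      refine ae_of_ae_map (f := Prod.snd) (p := fun p => p ∈ S₂) measurable_snd.aemeasurable ?_
      exact (Measure.absolutelyContinuous_of_le hσ₂).ae_le (ae_restrict_mem hS₂)
    filter_upwards [hσt, a₁, a₂] with q hq hq₁ hq₂
    exact hcross t ht0 ht1 q.1 q.2 hq fun e => hd.le_bot ⟨hq₁, e ▸ hq₂⟩
  rw [hσ0] at hσm
  exact hm0 (Measure.measure_univ_eq_zero.1 (by simpa using hσm.symm))

end Crossing

/-! ### Lower semicontinuity under weak convergence. -/

section Limits
variable {E : Type*} [MeasurableSpace E] [TopologicalSpace E] [BorelSpace E]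

/-- Portmanteau on open sets gives a Fatou inequality for nonnegative continuous costs, bounded or
not. The varying bound `a n` accommodates moving minimization problems. -/
lemma transportCost_le_of_tendsto {X : Type*} [TopologicalSpace X] [MeasurableSpace X]
    [OpensMeasurableSpace (X × X)] [HasOuterApproxClosed (X × X)] {c : X → X → ℝ}
    (hc : Continuous (Function.uncurry c))
    (h0 : ∀ x y, 0 ≤ c x y) {π : ℕ → ProbabilityMeasure (X × X)} {π' : ProbabilityMeasure (X × X)}
    (hπ : Tendsto π atTop (𝓝 π')) {a : ℕ → ℝ≥0∞} {b : ℝ≥0∞} (ha : Tendsto a atTop (𝓝 b))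
    (h : ∀ n, transportCost c (π n : Measure (X × X)) ≤ a n) :
    transportCost c (π' : Measure (X × X)) ≤ b := by
  refine (lintegral_le_liminf_lintegral_of_forall_isOpen_measure_le_liminf_measure
    (μs := fun n => (π n : Measure (X × X))) (f := fun p => c p.1 p.2) hc (fun p => h0 _ _)
    fun G hG => ProbabilityMeasure.le_liminf_measure_open_of_tendsto hπ hG).trans ?_
  rw [← ha.liminf_eq]
  exact liminf_le_liminf (Eventually.of_forall h)

/-- Portmanteau gives the bound on open sets, and outer regularity of `L` extends it to all
measurable sets. -/
lemma le_of_tendsto_of_le [HasOuterApproxClosed E] {m : ℕ → ProbabilityMeasure E}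
    {m' : ProbabilityMeasure E} (hm : Tendsto m atTop (𝓝 m')) {L : Measure E} [L.OuterRegular]
    (h : ∀ n, (m n : Measure E) ≤ L) : (m' : Measure E) ≤ L := by
  have hopen : ∀ U, IsOpen U → (m' : Measure E) U ≤ L U := by
    intro U hU
    refine (ProbabilityMeasure.le_liminf_measure_open_of_tendsto hm hU).trans ?_
    refine (liminf_le_liminf (v := fun _ => L U) (Eventually.of_forall fun n => h n U)).trans ?_
    simp
  refine Measure.le_iff.2 fun s hs => ?_
  rw [s.measure_eq_iInf_isOpen L]
  exact le_iInf₂ fun U hsU => le_iInf fun hU => (measure_mono hsU).trans (hopen U hU)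

/-- The direct method. Compactness of the minimizers is returned as well, so that the lemma can be
iterated for the second stage. -/
lemma exists_costMinimizer {X : Type*} [TopologicalSpace X] [MeasurableSpace X]
    [OpensMeasurableSpace (X × X)] [HasOuterApproxClosed (X × X)] {c : X → X → ℝ}
    (hc : Continuous (Function.uncurry c))
    (h0 : ∀ x y, 0 ≤ c x y) {S : Set (Measure (X × X))} (hS : S.Nonempty)
    (hprob : ∀ η ∈ S, IsProbabilityMeasure η)
    (hcomp : IsSeqCompact {p : ProbabilityMeasure (X × X) | (p : Measure (X × X)) ∈ S}) :
    (costMinimizers c S).Nonempty ∧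
      IsSeqCompact {p : ProbabilityMeasure (X × X) | (p : Measure (X × X)) ∈ costMinimizers c S} := by
  constructor
  · obtain ⟨u, -, hu, huS⟩ := exists_seq_tendsto_sInf (hS.image (transportCost c))
      (OrderBot.bddBelow _)
    choose η hη hηu using huS
    obtain ⟨π, hπ, φ, hφ, hlim⟩ :=
      hcomp (x := fun n => (⟨η n, hprob _ (hη n)⟩ : ProbabilityMeasure (X × X))) hη
    refine ⟨π, hπ, fun ξ hξ => ?_⟩
    refine (transportCost_le_of_tendsto hc h0 hlim (hu.comp hφ.tendsto_atTop)
      fun n => (hηu (φ n)).le).trans ?_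
    exact sInf_le ⟨ξ, hξ, rfl⟩
  · intro u hu
    obtain ⟨π, hπ, φ, hφ, hlim⟩ := hcomp fun n => (hu n).1
    exact ⟨π, ⟨hπ, fun ξ hξ => transportCost_le_of_tendsto hc h0 hlim
      tendsto_const_nhds fun n => (hu (φ n)).2 ξ hξ⟩, φ, hφ, hlim⟩

end Limits

lemma transportPlans_nonempty {E : Type*} [MeasurableSpace E] (μ ν : Measure E) [IsProbabilityMeasure μ] [IsProbabilityMeasure ν] :
    (transportPlans μ ν).Nonempty :=
  ⟨μ.prod ν, inferInstance, by simp [Measure.map_fst_prod], by simp [Measure.map_snd_prod]⟩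

/-! ### Compactness of plans and existence of minimizers. -/

section Compactness
variable {E : Type*} [MetricSpace E] [MeasurableSpace E] [BorelSpace E]
  [SecondCountableTopology E]

/-- Plans with tight marginals have weakly convergent subsequences. -/
lemma exists_subseq_tendsto_of_tight (π : ℕ → ProbabilityMeasure (E × E))
    (h₁ : IsTightMeasureSet (Set.range fun n => (π n : Measure (E × E)).fst))
    (h₂ : IsTightMeasureSet (Set.range fun n => (π n : Measure (E × E)).snd)) :
    ∃ π' : ProbabilityMeasure (E × E), ∃ φ : ℕ → ℕ, StrictMono φ ∧
      Tendsto (π ∘ φ) atTop (𝓝 π') := by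
  have e : {((p : ProbabilityMeasure (E × E)) : Measure (E × E)) | p ∈ Set.range π} =
      Set.range fun n => (π n : Measure (E × E)) := by ext; simp
  have ht : IsTightMeasureSet
      {((p : ProbabilityMeasure (E × E)) : Measure (E × E)) | p ∈ Set.range π} := by
    rw [e]
    refine IsTightMeasureSet.prodMk ?_ ?_
    · rwa [← Set.range_comp]
    · rwa [← Set.range_comp]
  obtain ⟨π', -, φ, hφ, hlim⟩ := (isCompact_closure_of_isTightMeasureSet ht).isSeqCompact
    (x := π) fun n => subset_closure ⟨n, rfl⟩
  exact ⟨π', φ, hφ, hlim⟩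

lemma fst_eq_of_tendsto {π : ℕ → ProbabilityMeasure (E × E)} {π' : ProbabilityMeasure (E × E)}
    (h : Tendsto π atTop (𝓝 π')) {μ : ℕ → ProbabilityMeasure E} {μ' : ProbabilityMeasure E}
    (hμ : ∀ n, (π n : Measure (E × E)).map Prod.fst = μ n) (hlim : Tendsto μ atTop (𝓝 μ')) :
    (π' : Measure (E × E)).map Prod.fst = μ' := by
  have h1 := ProbabilityMeasure.tendsto_map_of_tendsto_of_continuous _ _ h continuous_fst
  have h2 : (fun n => (π n).map (continuous_fst (X := E) (Y := E)).measurable.aemeasurable) = μ := by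
    ext1 n; exact Subtype.ext (hμ n)
  rw [h2] at h1
  exact congrArg (fun p : ProbabilityMeasure E => (p : Measure E)) (tendsto_nhds_unique h1 hlim)

lemma snd_eq_of_tendsto {π : ℕ → ProbabilityMeasure (E × E)} {π' : ProbabilityMeasure (E × E)}
    (h : Tendsto π atTop (𝓝 π')) {μ : ℕ → ProbabilityMeasure E} {μ' : ProbabilityMeasure E}
    (hμ : ∀ n, (π n : Measure (E × E)).map Prod.snd = μ n) (hlim : Tendsto μ atTop (𝓝 μ')) :
    (π' : Measure (E × E)).map Prod.snd = μ' := by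
  have h1 := ProbabilityMeasure.tendsto_map_of_tendsto_of_continuous _ _ h continuous_snd
  have h2 : (fun n => (π n).map (continuous_snd (X := E) (Y := E)).measurable.aemeasurable) = μ := by
    ext1 n; exact Subtype.ext (hμ n)
  rw [h2] at h1
  exact congrArg (fun p : ProbabilityMeasure E => (p : Measure E)) (tendsto_nhds_unique h1 hlim)

lemma isSeqCompact_transportPlans [CompleteSpace E] (μ ν : Measure E) [IsProbabilityMeasure μ]
    [IsProbabilityMeasure ν] :
    IsSeqCompact {p : ProbabilityMeasure (E × E) | (p : Measure (E × E)) ∈ transportPlans μ ν} := by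
  intro π hπ
  have e₁ : (fun n => (π n : Measure (E × E)).fst) = fun _ => μ := by ext1 n; exact (hπ n).2.1
  have e₂ : (fun n => (π n : Measure (E × E)).snd) = fun _ => ν := by ext1 n; exact (hπ n).2.2
  obtain ⟨π', φ, hφ, hlim⟩ := exists_subseq_tendsto_of_tight π
    (by rw [e₁, Set.range_const]; exact isTightMeasureSet_singleton)
    (by rw [e₂, Set.range_const]; exact isTightMeasureSet_singleton)
  refine ⟨π', ⟨inferInstance, ?_, ?_⟩, φ, hφ, hlim⟩
  · exact fst_eq_of_tendsto hlim (μ := fun _ => ⟨μ, inferInstance⟩) (μ' := ⟨μ, inferInstance⟩)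
      (fun n => (hπ (φ n)).2.1) tendsto_const_nhds
  · exact snd_eq_of_tendsto hlim (μ := fun _ => ⟨ν, inferInstance⟩) (μ' := ⟨ν, inferInstance⟩)
      (fun n => (hπ (φ n)).2.2) tendsto_const_nhds

/-- Existence for the two-stage minimization problem. -/
lemma secondary_minimizer_nonempty [CompleteSpace E] {c₁ c₂ : E → E → ℝ}
    (hc₁ : Continuous (Function.uncurry c₁)) (hc₂ : Continuous (Function.uncurry c₂))
    (h₁ : ∀ x y, 0 ≤ c₁ x y) (h₂ : ∀ x y, 0 ≤ c₂ x y) (μ ν : Measure E)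
    [IsProbabilityMeasure μ] [IsProbabilityMeasure ν] :
    (costMinimizers c₂ (costMinimizers c₁ (transportPlans μ ν))).Nonempty := by
  obtain ⟨hne, hcomp⟩ := exists_costMinimizer hc₁ h₁ (transportPlans_nonempty μ ν)
    (fun η hη => hη.1) (isSeqCompact_transportPlans μ ν)
  exact (exists_costMinimizer hc₂ h₂ hne (fun η hη => hη.1.1) hcomp).1

end Compactness

/-! ### The crossing inequality for the crystalline and Euclidean costs. -/

section Crystalline
variable {N : ℕ} (V : Finset (RN N))

lemma crystallineNorm_nonneg (x : RN N) : 0 ≤ crystallineNorm V x :=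
  Real.iSup_nonneg fun _ => abs_nonneg _

lemma abs_inner_le_crystallineNorm (x : RN N) (v : V) :
    |inner ℝ x (v : RN N)| ≤ crystallineNorm V x :=
  le_ciSup (f := fun v : V => |inner ℝ x (v : RN N)|) (Set.finite_range _).bddAbove v

lemma crystallineNorm_le {x : RN N} {a : ℝ} (ha : 0 ≤ a)
    (h : ∀ v ∈ V, |inner ℝ x v| ≤ a) : crystallineNorm V x ≤ a :=
  Real.iSup_le (fun v => h v v.2) ha

lemma crystallineNorm_combo_le {a b : ℝ} (ha : 0 ≤ a) (hb : 0 ≤ b) (x y : RN N) :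
    crystallineNorm V (a • x + b • y) ≤ a * crystallineNorm V x + b * crystallineNorm V y := by
  refine crystallineNorm_le V (add_nonneg (mul_nonneg ha (crystallineNorm_nonneg V x))
    (mul_nonneg hb (crystallineNorm_nonneg V y))) fun v hv => ?_
  rw [inner_add_left, real_inner_smul_left, real_inner_smul_left]
  refine (abs_add_le _ _).trans ?_
  rw [abs_mul, abs_mul, abs_of_nonneg ha, abs_of_nonneg hb]
  exact add_le_add (mul_le_mul_of_nonneg_left (abs_inner_le_crystallineNorm V x ⟨v, hv⟩) ha)
    (mul_le_mul_of_nonneg_left (abs_inner_le_crystallineNorm V y ⟨v, hv⟩) hb)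

lemma crystallineNorm_le_norm (x : RN N) :
    crystallineNorm V x ≤ (∑ v ∈ V, ‖v‖) * ‖x‖ := by
  refine crystallineNorm_le V (by positivity) fun v hv => ?_
  refine (abs_real_inner_le_norm x v).trans ?_
  rw [mul_comm]
  exact mul_le_mul_of_nonneg_right
    (Finset.single_le_sum (f := fun v => ‖v‖) (fun _ _ => norm_nonneg _) hv) (norm_nonneg _)

lemma continuous_crystallineNorm : Continuous (crystallineNorm V) := by
  refine (LipschitzWith.of_dist_le' (K := ∑ v ∈ V, ‖v‖) fun x y => ?_).continuous
  have key : ∀ x y, crystallineNorm V x - crystallineNorm V y ≤ (∑ v ∈ V, ‖v‖) * ‖x - y‖ := by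
    intro x y
    have h := crystallineNorm_combo_le V zero_le_one zero_le_one (x - y) y
    simp only [one_smul, sub_add_cancel, one_mul] at h
    linarith [crystallineNorm_le_norm V (x - y)]
  rw [Real.dist_eq, dist_eq_norm, abs_le]
  have := key y x
  rw [norm_sub_rev] at this
  exact ⟨by linarith, key x y⟩

lemma continuous_crystallineDist_sq :
    Continuous (Function.uncurry fun x y : RN N => crystallineDist V x y ^ 2) := by
  have := continuous_crystallineNorm V
  unfold crystallineDist Function.uncurry
  fun_prop

lemma continuous_dist_sq :
    Continuous (Function.uncurry fun x y : RN N => dist x y ^ 2) := by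
  unfold Function.uncurry
  fun_prop

/-- The exchanged displacements arise from the original ones by a doubly stochastic matrix, so
convex functions of displacement cannot increase in total. -/
lemma crossing_sub_eq {E : Type*} [AddCommGroup E] [Module ℝ E] {t : ℝ} {p q : E × E}
    (h : interp t p = interp t q) :
    p.1 - q.2 = t • (p.1 - p.2) + (1 - t) • (q.1 - q.2) ∧
      q.1 - p.2 = (1 - t) • (p.1 - p.2) + t • (q.1 - q.2) := by
  unfold interp at h
  constructor
  · have : p.1 - q.2 = t • (p.1 - p.2) + ((1 - t) • p.1 + t • p.2) - q.2 := by module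
    rw [this, h]; module
  · have : q.1 - p.2 = t • (q.1 - q.2) + ((1 - t) • q.1 + t • q.2) - p.2 := by module
    rw [this, ← h]; module

lemma crystallineDist_crossing {t : ℝ} (h0 : 0 < t) (h1 : t < 1) {p q : RN N × RN N}
    (h : interp t p = interp t q) :
    crystallineDist V p.1 q.2 ^ 2 + crystallineDist V q.1 p.2 ^ 2 ≤
      crystallineDist V p.1 p.2 ^ 2 + crystallineDist V q.1 q.2 ^ 2 := by
  obtain ⟨e₁, e₂⟩ := crossing_sub_eq h
  unfold crystallineDist
  have h1' : 0 ≤ 1 - t := by linarith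
  have i₁ := crystallineNorm_combo_le V h0.le h1' (p.1 - p.2) (q.1 - q.2)
  have i₂ := crystallineNorm_combo_le V h1' h0.le (p.1 - p.2) (q.1 - q.2)
  rw [← e₁] at i₁
  rw [← e₂] at i₂
  have j₁ := pow_le_pow_left₀ (crystallineNorm_nonneg V _) i₁ 2
  have j₂ := pow_le_pow_left₀ (crystallineNorm_nonneg V _) i₂ 2
  generalize crystallineNorm V (p.1 - p.2) = a at *
  generalize crystallineNorm V (q.1 - q.2) = b at *
  -- This is exactly `a² + b² - (ta + (1-t)b)² - ((1-t)a + tb)²`. It vanishes when `a = b`, so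
  -- strictness must come from the Euclidean cost.
  have : 0 ≤ 2 * (t * (1 - t)) * (a - b) ^ 2 := by positivity
  nlinarith

lemma dist_crossing {t : ℝ} (h0 : 0 < t) (h1 : t < 1) {p q : RN N × RN N}
    (h : interp t p = interp t q) (hne : p ≠ q) :
    dist p.1 q.2 ^ 2 + dist q.1 p.2 ^ 2 < dist p.1 p.2 ^ 2 + dist q.1 q.2 ^ 2 := by
  obtain ⟨e₁, e₂⟩ := crossing_sub_eq h
  -- A crossing point and a displacement determine the segment.
  have hne' : p.1 - p.2 ≠ q.1 - q.2 := by
    intro e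
    have e3 : p.1 = t • (p.1 - p.2) + interp t p := by unfold interp; module
    have e4 : q.1 = t • (q.1 - q.2) + interp t q := by unfold interp; module
    have h5 : p.1 = q.1 := by rw [e3, e4, e, h]
    refine hne (Prod.ext h5 ?_)
    rw [h5] at e
    exact sub_right_injective e
  simp only [dist_eq_norm]
  rw [e₁, e₂]
  generalize p.1 - p.2 = u at *
  generalize q.1 - q.2 = w at *
  have hpos : 0 < ‖u - w‖ ^ 2 := by
    have := norm_pos_iff.2 (sub_ne_zero.2 hne')
    positivity
  have k₁ := norm_add_sq_real (t • u) ((1 - t) • w)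
  have k₂ := norm_add_sq_real ((1 - t) • u) (t • w)
  have k₃ := norm_sub_sq_real u w
  simp only [norm_smul, real_inner_smul_left, real_inner_smul_right, mul_pow, Real.norm_eq_abs,
    sq_abs] at k₁ k₂
  have : 0 < 2 * (t * (1 - t)) * ‖u - w‖ ^ 2 := by
    have : 0 < 1 - t := by linarith
    positivity
  nlinarith

lemma crossingImproves_crystalline :
    CrossingImproves (fun x y : RN N => crystallineDist V x y ^ 2) (fun x y => dist x y ^ 2) :=
  fun _ h0 h1 _ _ h hne => ⟨crystallineDist_crossing V h0 h1 h, dist_crossing h0 h1 h hne⟩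

/-- With primary cost `0`, a one-stage problem for `c₁ + ε c₂` becomes an instance of the two-stage
one, and the singularity results apply to it unchanged. -/
lemma CrossingImproves.perturbed {E : Type*} [AddCommGroup E] [Module ℝ E] {c₁ c₂ : E → E → ℝ}
    (h : CrossingImproves c₁ c₂) {ε : ℝ} (hε : 0 < ε) :
    CrossingImproves (fun _ _ => 0) (fun x y => c₁ x y + ε * c₂ x y) := by
  intro t h0 h1 p q hpq hne
  obtain ⟨a, b⟩ := h t h0 h1 p q hpq hne
  exact ⟨le_rfl, by nlinarith⟩

lemma costMinimizers_zero {X Y : Type*} [MeasurableSpace X] [MeasurableSpace Y]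
    (S : Set (Measure (X × Y))) : costMinimizers (fun _ _ => 0) S = S := by
  ext π; simp [costMinimizers, transportCost]

end Crystalline

/-! ### The volume bound for finitely supported targets and its stability. -/

section Density
variable {N : ℕ}

/-- The interpolations of `π` obey the volume bound of a contraction towards a point. -/
def InterpBounded (M : ℝ≥0∞) (π : Measure (RN N × RN N)) : Prop :=
  ∀ t : ℝ, 0 < t → t < 1 →
    π.map (interp t) ≤ (M * ENNReal.ofReal (|((1 - t) ^ N)⁻¹|)) • (volume : Measure (RN N))

lemma map_homothety_volume {t : ℝ} (ht : t < 1) (y : RN N) :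
    (volume : Measure (RN N)).map (fun x => (1 - t) • x + t • y) =
      ENNReal.ofReal (|((1 - t) ^ N)⁻¹|) • volume := by
  have e : (fun x : RN N => (1 - t) • x + t • y) = (fun x => x + t • y) ∘ ((1 - t) • ·) := rfl
  rw [e, ← Measure.map_map (by fun_prop) (by fun_prop),
    Measure.map_addHaar_smul volume (by linarith : (1 - t) ≠ 0), Measure.map_smul,
    map_add_right_eq_self]
  simp

/-- The mass sent to one target `y` is moved by the homothety `x ↦ (1 - t)x + ty`, giving the bound
for that piece. Pieces with different targets are mutually singular, so the sum obeys the same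
bound, whatever the number of targets. -/
lemma interpBounded_of_finite_support {μ ν : Measure (RN N)} {c₁ c₂ : RN N → RN N → ℝ}
    (hc₁ : Measurable (Function.uncurry c₁)) (hc₂ : Measurable (Function.uncurry c₂))
    (h₁ : ∀ x y, 0 ≤ c₁ x y) (h₂ : ∀ x y, 0 ≤ c₂ x y) (hcross : CrossingImproves c₁ c₂)
    {π : Measure (RN N × RN N)}
    (hπ : π ∈ costMinimizers c₂ (costMinimizers c₁ (transportPlans μ ν)))
    (hfin : transportCost c₂ π ≠ ∞) {M : ℝ≥0∞} (hμ : μ ≤ M • volume) {F : Finset (RN N)}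
    (hF : ν (F : Set (RN N))ᶜ = 0) : InterpBounded M π := by
  intro t h0 h1
  have hS : ∀ y : RN N, MeasurableSet (Prod.snd ⁻¹' {y} : Set (RN N × RN N)) :=
    fun y => measurable_snd (measurableSet_singleton y)
  have hsum : π = ∑ y ∈ F, π.restrict (Prod.snd ⁻¹' {y}) := by
    have hU : (⋃ y ∈ F, Prod.snd ⁻¹' {y} : Set (RN N × RN N)) = Prod.snd ⁻¹' F := by
      ext p; simp
    have h := Measure.restrict_biUnion_finset (μ := π) (T := F)
      (s := fun y => (Prod.snd ⁻¹' {y} : Set (RN N × RN N)))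
      (fun a _ b _ hab => Disjoint.preimage _ (by simpa using hab)) hS
    rw [hU, Measure.sum_coe_finset (s := F) (μ := fun y => π.restrict (Prod.snd ⁻¹' {y}))] at h
    rw [← h, Measure.restrict_eq_self_of_ae_mem]
    rw [ae_iff]
    have := hπ.1.1.2.2
    rw [← this, Measure.map_apply measurable_snd F.measurableSet.compl] at hF
    exact hF
  have hpiece : ∀ y ∈ F, (π.restrict (Prod.snd ⁻¹' {y})).map (interp t) ≤
      (M * ENNReal.ofReal (|((1 - t) ^ N)⁻¹|)) • (volume : Measure (RN N)) := by
    intro y _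
    have hm : Measurable fun x : RN N => (1 - t) • x + t • y := by fun_prop
    have hae : interp t =ᵐ[π.restrict (Prod.snd ⁻¹' {y})]
        (fun x : RN N => (1 - t) • x + t • y) ∘ Prod.fst := by
      filter_upwards [ae_restrict_mem (hS y)] with p hp
      have hp' : p.2 = y := hp
      simp [interp, hp']
    rw [Measure.map_congr hae, ← Measure.map_map hm measurable_fst]
    calc _ ≤ (π.map Prod.fst).map (fun x : RN N => (1 - t) • x + t • y) :=
          Measure.map_mono (Measure.map_mono Measure.restrict_le_self measurable_fst) hm
      _ = μ.map (fun x : RN N => (1 - t) • x + t • y) := by rw [hπ.1.1.2.1]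
      _ ≤ (M • volume).map (fun x : RN N => (1 - t) • x + t • y) := Measure.map_mono hμ hm
      _ = _ := by rw [Measure.map_smul, map_homothety_volume h1, smul_smul]
  rw [hsum, Measure.map_finset_sum (measurable_interp t).aemeasurable]
  refine finset_sum_le_of_mutuallySingular F (fun a _ b _ hab => ?_) hpiece
  exact mutuallySingular_map_interp hc₁ hc₂ h₁ h₂ hcross hπ hfin (hS a) (hS b)
    (Disjoint.preimage _ (by simpa using hab)) h0 h1

lemma InterpBounded.of_tendsto {M : ℝ≥0∞} (hM : M ≠ ∞) {π : ℕ → ProbabilityMeasure (RN N × RN N)}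
    {π' : ProbabilityMeasure (RN N × RN N)} (hlim : Tendsto π atTop (𝓝 π'))
    (h : ∀ n, InterpBounded M (π n : Measure (RN N × RN N))) :
    InterpBounded M (π' : Measure (RN N × RN N)) := by
  intro t h0 h1
  have h2 := ProbabilityMeasure.tendsto_map_of_tendsto_of_continuous _ _ hlim
    (continuous_interp (E := RN N) t)
  have : ((M * ENNReal.ofReal (|((1 - t) ^ N)⁻¹|)) • (volume : Measure (RN N))).OuterRegular :=
    Measure.OuterRegular.smul _ (ENNReal.mul_ne_top hM ENNReal.ofReal_ne_top)
  exact le_of_tendsto_of_le h2 fun n => h n t h0 h1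

end Density

/-! ### Minimizers with the volume bound. -/

section GoodPlans
variable {N : ℕ}

lemma transportCost_add_mul {X Y : Type*} [MeasurableSpace X] [MeasurableSpace Y]
    {c₁ c₂ : X → Y → ℝ} (hc₁ : Measurable (Function.uncurry c₁))
    (hc₂ : Measurable (Function.uncurry c₂))
    (h₁ : ∀ x y, 0 ≤ c₁ x y) (h₂ : ∀ x y, 0 ≤ c₂ x y) {ε : ℝ} (hε : 0 ≤ ε)
    (π : Measure (X × Y)) :
    transportCost (fun x y => c₁ x y + ε * c₂ x y) π =
      transportCost c₁ π + ENNReal.ofReal ε * transportCost c₂ π := by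
  have m₁ : Measurable fun p : X × Y => ENNReal.ofReal (c₁ p.1 p.2) := hc₁.ennreal_ofReal
  have m₂ : Measurable fun p : X × Y => ENNReal.ofReal (c₂ p.1 p.2) := hc₂.ennreal_ofReal
  unfold transportCost
  rw [← lintegral_const_mul _ m₂, ← lintegral_add_left m₁]
  refine lintegral_congr fun p => ?_
  rw [ENNReal.ofReal_add (h₁ _ _) (mul_nonneg hε (h₂ _ _)), ENNReal.ofReal_mul hε]

lemma ae_norm_le_of_mem_transportPlans {E : Type*} [NormedAddCommGroup E] [MeasurableSpace E]
    {μ ν : Measure E} {R : ℝ} (hμ : ∀ᵐ x ∂μ, ‖x‖ ≤ R) (hν : ∀ᵐ x ∂ν, ‖x‖ ≤ R)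
    {π : Measure (E × E)} (hπ : π ∈ transportPlans μ ν) :
    ∀ᵐ p ∂π, ‖p.1‖ ≤ R ∧ ‖p.2‖ ≤ R := by
  rw [← hπ.2.1] at hμ
  rw [← hπ.2.2] at hν
  filter_upwards [ae_of_ae_map measurable_fst.aemeasurable hμ,
    ae_of_ae_map measurable_snd.aemeasurable hν] with p h1 h2 using ⟨h1, h2⟩

lemma exists_cost_bound {c : RN N → RN N → ℝ} (hc : Continuous (Function.uncurry c)) (R : ℝ) :
    ∃ B : ℝ, ∀ x y : RN N, ‖x‖ ≤ R → ‖y‖ ≤ R → c x y ≤ B := by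
  obtain ⟨B, hB⟩ := ((isCompact_closedBall (0 : RN N) R).prod
    (isCompact_closedBall (0 : RN N) R)).bddAbove_image hc.continuousOn
  exact ⟨B, fun x y hx hy => hB ⟨(x, y), by simp [hx, hy], rfl⟩⟩

lemma transportCost_ne_top_of_bounded {c : RN N → RN N → ℝ}
    (hc : Continuous (Function.uncurry c)) {μ ν : Measure (RN N)} {R : ℝ}
    (hμ : ∀ᵐ x ∂μ, ‖x‖ ≤ R) (hν : ∀ᵐ x ∂ν, ‖x‖ ≤ R)
    {π : Measure (RN N × RN N)} (hπ : π ∈ transportPlans μ ν) : transportCost c π ≠ ∞ := by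
  obtain ⟨B, hB⟩ := exists_cost_bound hc R
  have : IsProbabilityMeasure π := hπ.1
  have h : transportCost c π ≤ ∫⁻ _, ENNReal.ofReal B ∂π := by
    refine lintegral_mono_ae ?_
    filter_upwards [ae_norm_le_of_mem_transportPlans hμ hν hπ] with p hp
    exact ENNReal.ofReal_le_ofReal (hB _ _ hp.1 hp.2)
  refine (h.trans_lt ?_).ne
  simp

/-- For a cost that is strictly improved at crossings there is an optimal plan obeying the volume
bound, obtained by approximating the target by finitely supported measures. -/
lemma exists_interpBounded_minimizer {c : RN N → RN N → ℝ}
    (hc : Continuous (Function.uncurry c)) (h0 : ∀ x y, 0 ≤ c x y)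
    (hcross : CrossingImproves (fun _ _ => 0) c) {μ ν : Measure (RN N)} [IsProbabilityMeasure μ]
    [IsProbabilityMeasure ν] {R : ℝ} (hR : 0 ≤ R) (hμ : ∀ᵐ x ∂μ, ‖x‖ ≤ R)
    (hν : ∀ᵐ x ∂ν, ‖x‖ ≤ R) {M : ℝ≥0∞} (hM : M ≠ ∞) (hμM : μ ≤ M • volume) :
    ∃ π ∈ costMinimizers c (transportPlans μ ν), InterpBounded M π := by
  -- Simple functions approximating the identity push `ν` to finitely supported measures that stay
  -- in the ball of radius `R`.
  have hid : StronglyMeasurable (id : RN N → RN N) := stronglyMeasurable_id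
  set q : ℕ → SimpleFunc (RN N) (RN N) := fun n => hid.approxBounded R n with hq
  have hqR : ∀ n y, ‖q n y‖ ≤ R := fun n y => hid.norm_approxBounded_le hR n y
  have hqlim : ∀ y, ‖y‖ ≤ R → Tendsto (fun n => q n y) atTop (𝓝 y) :=
    fun y hy => hid.tendsto_approxBounded_of_norm_le (f := id) hy
  have hprob : ∀ n, IsProbabilityMeasure (ν.map (q n)) :=
    fun n => Measure.isProbabilityMeasure_map (q n).measurable.aemeasurable
  have hνn : ∀ n, ∀ᵐ y ∂ν.map (q n), ‖y‖ ≤ R := by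
    intro n
    rw [ae_map_iff (q n).measurable.aemeasurable (measurableSet_le measurable_norm measurable_const)]
    exact ae_of_all _ (hqR n)
  have hmin : ∀ n, ∃ π ∈ costMinimizers c (transportPlans μ (ν.map (q n))), InterpBounded M π := by
    intro n
    obtain ⟨π, hπ⟩ := secondary_minimizer_nonempty (c₁ := fun _ _ => 0) continuous_const hc
      (fun _ _ => le_rfl) h0 μ (ν.map (q n))
    refine ⟨π, by rwa [costMinimizers_zero] at hπ, ?_⟩
    refine interpBounded_of_finite_support (F := (q n).range) measurable_const hc.measurable
      (fun _ _ => le_rfl) h0 hcross hπ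
      (transportCost_ne_top_of_bounded hc hμ (hνn n) hπ.1.1) hμM ?_
    rw [Measure.map_apply (q n).measurable (q n).range.measurableSet.compl]
    convert measure_empty (μ := ν)
    ext y; simp
  choose π hπ hπM using hmin
  have hπp : ∀ n, IsProbabilityMeasure (π n) := fun n => (hπ n).1.1
  set p : ℕ → ProbabilityMeasure (RN N × RN N) := fun n => ⟨π n, hπp n⟩ with hp
  have hfst : ∀ n, (π n).fst = μ := fun n => (hπ n).1.2.1
  have hsnd : ∀ n, (π n).snd = ν.map (q n) := fun n => (hπ n).1.2.2
  obtain ⟨p', φ, hφ, hlim⟩ := exists_subseq_tendsto_of_tight p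
    (by
      have e : (fun n => ((p n : ProbabilityMeasure (RN N × RN N)) :
        Measure (RN N × RN N)).fst) = fun _ => μ := by ext1 n; exact hfst n
      rw [e, Set.range_const]; exact isTightMeasureSet_singleton)
    (by
      rw [isTightMeasureSet_iff_exists_isCompact_measure_compl_le]
      refine fun ε _ => ⟨Metric.closedBall 0 R, isCompact_closedBall _ _, ?_⟩
      rintro _ ⟨n, rfl⟩
      have h := hνn n
      rw [← hsnd n, ae_iff] at h
      refine (measure_mono_null ?_ h).le.trans (zero_le)
      intro y hy
      simpa using hy)
  let νs : ℕ → ProbabilityMeasure (RN N) := fun n => ⟨ν.map (q n), hprob n⟩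
  let ν' : ProbabilityMeasure (RN N) := ⟨ν, inferInstance⟩
  have hνlim : Tendsto νs atTop (𝓝 ν') := by
    rw [ProbabilityMeasure.tendsto_iff_forall_integral_tendsto]
    intro f
    change Tendsto (fun n => ∫ y, f y ∂ν.map (q n)) atTop (𝓝 (∫ y, f y ∂ν))
    have e : ∀ n, ∫ y, f y ∂ν.map (q n) = ∫ y, f (q n y) ∂ν := fun n =>
      integral_map (q n).measurable.aemeasurable f.continuous.aestronglyMeasurable
    simp_rw [e]
    refine tendsto_integral_of_dominated_convergence (fun _ => ‖f‖)
      (fun n => (f.continuous.measurable.comp (q n).measurable).aestronglyMeasurable)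
      (integrable_const _) (fun n => ae_of_all _ fun y => f.norm_coe_le_norm _) ?_
    filter_upwards [hν] with y hy
    exact (f.continuous.tendsto y).comp (hqlim y hy)
  have hplan : (p' : Measure (RN N × RN N)) ∈ transportPlans μ ν :=
    ⟨inferInstance,
      fst_eq_of_tendsto hlim (μ := fun _ => ⟨μ, inferInstance⟩) (μ' := ⟨μ, inferInstance⟩)
        (fun n => hfst (φ n)) tendsto_const_nhds,
      snd_eq_of_tendsto hlim (μ := νs ∘ φ) (μ' := ν') (fun n => hsnd (φ n)) (hνlim.comp hφ.tendsto_atTop)⟩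
  refine ⟨p', ⟨hplan, fun η hη => ?_⟩, InterpBounded.of_tendsto hM hlim fun n => hπM (φ n)⟩
  have : IsProbabilityMeasure η := hη.1
  -- To compare the limit with a competitor `η`, move its targets by `q n`: this gives a competitor
  -- for the `n`th problem, with cost tending to that of `η`.
  have hm : ∀ n, Measurable (Prod.map id (q n) : RN N × RN N → RN N × RN N) :=
    fun n => measurable_id.prodMap (q n).measurable
  have hηn : ∀ n, η.map (Prod.map id (q n)) ∈ transportPlans μ (ν.map (q n)) := by
    intro n
    refine ⟨Measure.isProbabilityMeasure_map (hm n).aemeasurable, ?_, ?_⟩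
    · rw [Measure.map_map measurable_fst (hm n)]
      exact hη.2.1
    · rw [Measure.map_map measurable_snd (hm n), ← hη.2.2,
        Measure.map_map (q n).measurable measurable_snd]
      rfl
  have hmc : Measurable fun p : RN N × RN N => ENNReal.ofReal (c p.1 p.2) :=
    hc.measurable.ennreal_ofReal
  have hcost : Tendsto (fun n => transportCost c (η.map (Prod.map id (q n)))) atTop
      (𝓝 (transportCost c η)) := by
    have e : ∀ n, transportCost c (η.map (Prod.map id (q n))) =
        ∫⁻ p, ENNReal.ofReal (c p.1 (q n p.2)) ∂η := fun n => lintegral_map hmc (hm n)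
    simp_rw [e]
    obtain ⟨B, hB⟩ := exists_cost_bound hc R
    have hae := ae_norm_le_of_mem_transportPlans hμ hν hη
    refine tendsto_lintegral_of_dominated_convergence (fun _ => ENNReal.ofReal B)
      (fun n => hmc.comp (hm n)) (fun n => ?_) (by simp) ?_
    · filter_upwards [hae] with p hp
      exact ENNReal.ofReal_le_ofReal (hB _ _ hp.1 (hqR n _))
    · filter_upwards [hae] with p hp
      refine (ENNReal.continuous_ofReal.tendsto _).comp ?_
      exact (hc.tendsto (p.1, p.2)).comp (tendsto_const_nhds.prodMk_nhds (hqlim _ hp.2))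
  exact transportCost_le_of_tendsto hc h0 hlim (hcost.comp hφ.tendsto_atTop)
    fun n => (hπ (φ n)).2 _ (hηn (φ n))

/-- Some lexicographically optimal plan obeys the volume bound: take a limit of optimal plans for
`c₁ + ε c₂`. -/
lemma exists_interpBounded_secondary_minimizer {c₁ c₂ : RN N → RN N → ℝ}
    (hc₁ : Continuous (Function.uncurry c₁)) (hc₂ : Continuous (Function.uncurry c₂))
    (h₁ : ∀ x y, 0 ≤ c₁ x y) (h₂ : ∀ x y, 0 ≤ c₂ x y) (hcross : CrossingImproves c₁ c₂)
    {μ ν : Measure (RN N)} [IsProbabilityMeasure μ]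
    [IsProbabilityMeasure ν] {R : ℝ} (hR : 0 ≤ R) (hμ : ∀ᵐ x ∂μ, ‖x‖ ≤ R)
    (hν : ∀ᵐ x ∂ν, ‖x‖ ≤ R) {M : ℝ≥0∞} (hM : M ≠ ∞) (hμM : μ ≤ M • volume) :
    ∃ π ∈ costMinimizers c₂ (costMinimizers c₁ (transportPlans μ ν)), InterpBounded M π := by
  have hε : ∀ n : ℕ, (0 : ℝ) < 1 / ((n : ℝ) + 1) := fun n => by positivity
  have hex := fun n : ℕ => exists_interpBounded_minimizer (μ := μ) (ν := ν)
    (c := fun x y => c₁ x y + 1 / ((n : ℝ) + 1) * c₂ x y)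
    (hc₁.add (continuous_const.mul hc₂))
    (fun x y => add_nonneg (h₁ x y) (mul_nonneg (hε n).le (h₂ x y)))
    (hcross.perturbed (hε n)) hR hμ hν hM hμM
  choose π hπ hπM using hex
  have hcost : ∀ (n : ℕ) (η : Measure (RN N × RN N)),
      transportCost (fun x y => c₁ x y + 1 / ((n : ℝ) + 1) * c₂ x y) η =
        transportCost c₁ η + ENNReal.ofReal (1 / ((n : ℝ) + 1)) * transportCost c₂ η :=
    fun n η => transportCost_add_mul hc₁.measurable hc₂.measurable h₁ h₂ (hε n).le η
  have hopt : ∀ (n : ℕ), ∀ η ∈ transportPlans μ ν,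
      transportCost c₁ (π n) + ENNReal.ofReal (1 / ((n : ℝ) + 1)) * transportCost c₂ (π n) ≤
        transportCost c₁ η + ENNReal.ofReal (1 / ((n : ℝ) + 1)) * transportCost c₂ η := by
    intro n η hη
    rw [← hcost, ← hcost]
    exact (hπ n).2 η hη
  have hπp : ∀ n, IsProbabilityMeasure (π n) := fun n => (hπ n).1.1
  obtain ⟨p', hp', φ, hφ, hlim⟩ := isSeqCompact_transportPlans μ ν
    (x := fun n => (⟨π n, hπp n⟩ : ProbabilityMeasure (RN N × RN N))) fun n => (hπ n).1
  refine ⟨p', ⟨⟨hp', fun η hη => ?_⟩, fun η hη => ?_⟩,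
    InterpBounded.of_tendsto hM hlim fun n => hπM (φ n)⟩
  -- Primary optimality: drop the `c₂` term of `π n` and let the weight of the finite quantity
  -- `transportCost c₂ η` tend to `0`.
  · have hlim0 : Tendsto (fun n : ℕ => transportCost c₁ η +
        ENNReal.ofReal (1 / ((n : ℝ) + 1)) * transportCost c₂ η) atTop
        (𝓝 (transportCost c₁ η)) := by
      have h := ENNReal.tendsto_ofReal (tendsto_one_div_add_atTop_nhds_zero_nat (𝕜 := ℝ))
      have h' := (ENNReal.Tendsto.mul_const h
        (Or.inr (transportCost_ne_top_of_bounded hc₂ hμ hν hη))).const_add (transportCost c₁ η)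
      simpa using h'
    exact transportCost_le_of_tendsto hc₁ h₁ hlim (hlim0.comp hφ.tendsto_atTop)
      fun n => le_self_add.trans (hopt (φ n) η hη)
  -- Secondary optimality: `η` has the least `c₁`-cost, so the `c₁` terms cancel, and then the
  -- weight does. The bound on `c₂` already holds for every `n`.
  · refine transportCost_le_of_tendsto hc₂ h₂ hlim tendsto_const_nhds fun n => ?_
    have h := (add_le_add (hη.2 _ (hπ (φ n)).1) le_rfl).trans (hopt (φ n) η hη.1)
    rw [ENNReal.add_le_add_iff_left (transportCost_ne_top_of_bounded hc₁ hμ hν hη.1)] at h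
    exact (ENNReal.mul_le_mul_iff_right (by simpa using hε _) ENNReal.ofReal_ne_top).1 h

end GoodPlans

/-! ### Local replacement in optimal plans. -/

section Replacement
variable {X Y : Type*} [MeasurableSpace X] [MeasurableSpace Y]

/-- Replacing a part of an optimal plan by an optimal plan with the same marginals. -/
lemma replace_mem_costMinimizers {c₁ c₂ : X → Y → ℝ} {μ μ' : Measure X} {ν ν' : Measure Y}
    {r π π' : Measure (X × Y)} {θ : ℝ≥0∞} (hθ0 : θ ≠ 0) (hθ : θ ≠ ∞)
    (hmem : r + θ • π ∈ costMinimizers c₂ (costMinimizers c₁ (transportPlans μ ν)))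
    (hf₁ : transportCost c₁ (r + θ • π) ≠ ∞) (hπ : π ∈ transportPlans μ' ν')
    (hπ' : π' ∈ costMinimizers c₂ (costMinimizers c₁ (transportPlans μ' ν'))) :
    r + θ • π' ∈ costMinimizers c₂ (costMinimizers c₁ (transportPlans μ ν)) := by
  obtain ⟨⟨⟨hp, hfst, hsnd⟩, hmin₁⟩, hmin₂⟩ := hmem
  have hr : transportCost c₁ r ≠ ∞ :=
    ne_top_of_le_ne_top hf₁ (transportCost_mono _ (Measure.le_add_right le_rfl))
  have hfst' : (r + θ • π').map Prod.fst = μ := by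
    rw [← hfst, Measure.map_add _ _ measurable_fst, Measure.map_add _ _ measurable_fst,
      Measure.map_smul, Measure.map_smul, hπ.2.1, hπ'.1.1.2.1]
  have hplan : r + θ • π' ∈ transportPlans μ ν := by
    refine ⟨⟨?_⟩, hfst', ?_⟩
    · have h := hp.measure_univ
      rw [← Set.preimage_univ (f := Prod.fst), ← Measure.map_apply measurable_fst .univ] at h ⊢
      rwa [hfst', ← hfst]
    · rw [← hsnd, Measure.map_add _ _ measurable_snd, Measure.map_add _ _ measurable_snd,
        Measure.map_smul, Measure.map_smul, hπ.2.2, hπ'.1.1.2.2]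
  have hle₁ : transportCost c₁ (r + θ • π') ≤ transportCost c₁ (r + θ • π) := by
    rw [transportCost_add, transportCost_add, transportCost_smul, transportCost_smul]
    gcongr
    exact hπ'.1.2 _ hπ
  have hmem' : r + θ • π' ∈ costMinimizers c₁ (transportPlans μ ν) :=
    ⟨hplan, fun η hη => hle₁.trans (hmin₁ η hη)⟩
  -- Primary optimality of the whole forces it on the part, which makes `π` a legitimate competitor
  -- of `π'` in the second stage.
  have hπ₁ : transportCost c₁ π ≤ transportCost c₁ π' := by
    have h := hmin₁ _ hplan
    rw [transportCost_add, transportCost_add, transportCost_smul, transportCost_smul,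
      ENNReal.add_le_add_iff_left hr] at h
    exact (ENNReal.mul_le_mul_iff_right hθ0 hθ).1 h
  have hπmem : π ∈ costMinimizers c₁ (transportPlans μ' ν') :=
    ⟨hπ, fun η hη => hπ₁.trans (hπ'.1.2 η hη)⟩
  refine ⟨hmem', fun η hη => le_trans ?_ (hmin₂ η hη)⟩
  rw [transportCost_add, transportCost_add, transportCost_smul, transportCost_smul]
  gcongr
  exact hπ'.2 _ hπmem

end Replacement

/-! ### Short-time contradiction and singularity of first marginals. -/

/-- A nonzero absolutely continuous measure dominates a multiple of Lebesgue measure on a compact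
set of positive volume. -/
lemma exists_smul_restrict_le {N : ℕ} {m : Measure (RN N)} [IsFiniteMeasure m] (hm : m ≠ 0)
    (hac : m ≪ volume) : ∃ (A : Set (RN N)) (a : ℝ≥0∞), IsCompact A ∧ volume A ≠ 0 ∧ a ≠ 0 ∧ a ≠ ∞ ∧
      a • volume.restrict A ≤ m := by
  set f := m.rnDeriv volume with hf
  have hfm : Measurable f := Measure.measurable_rnDeriv _ _
  have hmf : volume.withDensity f = m := Measure.withDensity_rnDeriv_eq _ _ hac
  have hex : ∃ n : ℕ, volume {x | ((n : ℝ≥0∞) + 1)⁻¹ ≤ f x} ≠ 0 := by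
    by_contra! h
    refine hm ?_
    rw [← hmf, withDensity_eq_zero_iff hfm.aemeasurable]
    have h' := measure_iUnion_null h
    refine measure_mono_null (fun x hx => ?_) h'
    obtain ⟨n, hn⟩ := ENNReal.exists_inv_nat_lt (a := f x) hx
    refine Set.mem_iUnion.2 ⟨n, le_trans ?_ hn.le⟩
    exact ENNReal.inv_le_inv.2 le_self_add
  obtain ⟨n, hn⟩ := hex
  have hS : MeasurableSet {x | ((n : ℝ≥0∞) + 1)⁻¹ ≤ f x} := measurableSet_le measurable_const hfm
  obtain ⟨A, hAS, hA, hA0⟩ := hS.exists_lt_isCompact (pos_iff_ne_zero.2 hn)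
  refine ⟨A, ((n : ℝ≥0∞) + 1)⁻¹, hA, hA0.ne', by simp, by simp, Measure.le_iff.2 fun s hs => ?_⟩
  rw [← hmf, withDensity_apply _ hs, Measure.smul_apply, Measure.restrict_apply hs, smul_eq_mul]
  calc ((n : ℝ≥0∞) + 1)⁻¹ * volume (s ∩ A) = ∫⁻ _ in s ∩ A, ((n : ℝ≥0∞) + 1)⁻¹ := by simp
    _ ≤ ∫⁻ x in s ∩ A, f x := setLIntegral_mono hfm fun x hx => hAS hx.2
    _ ≤ ∫⁻ x in s, f x := lintegral_mono_set Set.inter_subset_left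

section Singular
variable {N : ℕ}

lemma interp_mem_cthickening {A : Set (RN N)} {R t : ℝ} (ht : 0 ≤ t) {p : RN N × RN N}
    (hp : p.1 ∈ A) (h₁ : ‖p.1‖ ≤ R) (h₂ : ‖p.2‖ ≤ R) :
    interp t p ∈ Metric.cthickening (t * (2 * R)) A := by
  refine Metric.mem_cthickening_of_dist_le _ p.1 _ _ hp ?_
  have e : interp t p - p.1 = t • (p.2 - p.1) := by unfold interp; module
  rw [dist_eq_norm, e, norm_smul, Real.norm_of_nonneg ht]
  refine mul_le_mul_of_nonneg_left ((norm_sub_le _ _).trans ?_) ht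
  linarith

/-- Two plans from the same uniform distribution cannot both obey the volume bound and have mutually
singular interpolations. -/
lemma not_forall_mutuallySingular_interp {A : Set (RN N)} (hA : IsCompact A) (hA0 : volume A ≠ 0)
    {R : ℝ} {π₁ π₂ : Measure (RN N × RN N)} [IsProbabilityMeasure π₁] [IsProbabilityMeasure π₂]
    (hA₁ : ∀ᵐ p ∂π₁, p.1 ∈ A ∧ ‖p.1‖ ≤ R ∧ ‖p.2‖ ≤ R)
    (hA₂ : ∀ᵐ p ∂π₂, p.1 ∈ A ∧ ‖p.1‖ ≤ R ∧ ‖p.2‖ ≤ R)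
    (h₁ : InterpBounded (volume A)⁻¹ π₁) (h₂ : InterpBounded (volume A)⁻¹ π₂)
    (hs : ∀ t : ℝ, 0 < t → t < 1 → π₁.map (interp t) ⟂ₘ π₂.map (interp t)) : False := by
  -- Both interpolations put mass `1` in the `2Rt`-thickening of `A`, and singularity lets them
  -- share a single volume bound. The right side tends to `1` as `t → 0`.
  have key : ∀ t : ℝ, 0 < t → t < 1 → (2 : ℝ≥0∞) ≤
      (volume A)⁻¹ * ENNReal.ofReal (|((1 - t) ^ N)⁻¹|) *
        volume (Metric.cthickening (t * (2 * R)) A) := by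
    intro t h0 t1
    set C := Metric.cthickening (t * (2 * R)) A with hC
    have hCm : MeasurableSet C := Metric.isClosed_cthickening.measurableSet
    have hone : ∀ (π : Measure (RN N × RN N)) [IsProbabilityMeasure π],
        (∀ᵐ p ∂π, p.1 ∈ A ∧ ‖p.1‖ ≤ R ∧ ‖p.2‖ ≤ R) → π.map (interp t) C = 1 := by
      intro π _ hπ
      rw [Measure.map_apply (measurable_interp t) hCm, prob_compl_eq_zero_iff
        (measurable_interp t hCm) |>.symm]
      refine measure_mono_null (fun p hp => ?_) (ae_iff.1 hπ)
      exact fun h => hp (interp_mem_cthickening h0.le h.1 h.2.1 h.2.2)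
    have h := add_le_of_mutuallySingular (hs t h0 t1) (h₁ t h0 t1) (h₂ t h0 t1) C
    rw [Measure.add_apply, hone π₁ hA₁, hone π₂ hA₂, one_add_one_eq_two, Measure.smul_apply,
      smul_eq_mul] at h
    exact h
  have hv : volume A ≠ ∞ := hA.measure_lt_top.ne
  have lim₁ : Tendsto (fun t : ℝ => volume (Metric.cthickening (t * (2 * R)) A)) (𝓝[>] 0)
      (𝓝 (volume A)) := by
    have h := tendsto_measure_cthickening_of_isCompact (μ := (volume : Measure (RN N))) hA
    refine (h.comp (y := 𝓝 0) ?_).mono_left nhdsWithin_le_nhds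
    exact Continuous.tendsto' (by fun_prop) _ _ (by simp)
  have lim₂ : Tendsto (fun t : ℝ => ENNReal.ofReal (|((1 - t) ^ N)⁻¹|)) (𝓝[>] 0) (𝓝 1) := by
    have hc : ContinuousAt (fun t : ℝ => |((1 - t) ^ N)⁻¹|) 0 :=
      (ContinuousAt.inv₀ (by fun_prop) (by simp)).abs
    have h := (ENNReal.continuous_ofReal.tendsto _).comp hc.tendsto
    simp only [sub_zero, one_pow, inv_one, abs_one, ENNReal.ofReal_one] at h
    exact h.mono_left nhdsWithin_le_nhds
  have lim₃ := ENNReal.Tendsto.mul (ENNReal.Tendsto.const_mul (a := (volume A)⁻¹) lim₂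
    (Or.inl one_ne_zero)) (Or.inl (by simpa using hv)) lim₁ (Or.inl hA0)
  rw [mul_one, ENNReal.inv_mul_cancel hA0 hv] at lim₃
  have hev : ∀ᶠ t : ℝ in 𝓝[>] 0, (2 : ℝ≥0∞) ≤
      (volume A)⁻¹ * ENNReal.ofReal (|((1 - t) ^ N)⁻¹|) *
        volume (Metric.cthickening (t * (2 * R)) A) := by
    filter_upwards [Ioo_mem_nhdsGT (zero_lt_one' ℝ)] with t ht using key t ht.1 ht.2
  have := ge_of_tendsto lim₃ hev
  exact absurd this (by norm_num)

variable {c₁ c₂ : RN N → RN N → ℝ} {μ ν : Measure (RN N)}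

/-- The parts of an optimal plan with targets in disjoint bounded sets have mutually singular
first marginals. -/
lemma mutuallySingular_fst_restrict_of_bounded
    (hc₁ : Continuous (Function.uncurry c₁)) (hc₂ : Continuous (Function.uncurry c₂))
    (h₁ : ∀ x y, 0 ≤ c₁ x y) (h₂ : ∀ x y, 0 ≤ c₂ x y) (hcross : CrossingImproves c₁ c₂)
    (hac : μ ≪ volume) (hf₁ : ∀ η ∈ transportPlans μ ν, transportCost c₁ η ≠ ∞)
    (hf₂ : ∀ η ∈ transportPlans μ ν, transportCost c₂ η ≠ ∞)
    {π : Measure (RN N × RN N)}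
    (hπ : π ∈ costMinimizers c₂ (costMinimizers c₁ (transportPlans μ ν)))
    {B₁ B₂ : Set (RN N)} (hB₁ : MeasurableSet B₁) (hB₂ : MeasurableSet B₂) (hd : Disjoint B₁ B₂)
    {R : ℝ} (hR₁ : ∀ y ∈ B₁, ‖y‖ ≤ R) (hR₂ : ∀ y ∈ B₂, ‖y‖ ≤ R) :
    (π.restrict (Prod.snd ⁻¹' B₁)).fst ⟂ₘ (π.restrict (Prod.snd ⁻¹' B₂)).fst := by
  have : IsProbabilityMeasure π := hπ.1.1.1
  by_contra hns
  obtain ⟨m, hm0, hm₁, hm₂⟩ := exists_common_part hns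
  have : IsFiniteMeasure m := isFiniteMeasure_of_le _ hm₁
  have hmμ : m ≤ μ := by
    rw [← hπ.1.1.2.1]
    exact hm₁.trans (Measure.map_mono Measure.restrict_le_self measurable_fst)
  obtain ⟨A, a, hA, hA0, ha0, ha, hle⟩ :=
    exists_smul_restrict_le hm0 ((Measure.absolutelyContinuous_of_le hmμ).trans hac)
  have hv : volume A ≠ ∞ := hA.measure_lt_top.ne
  obtain ⟨R', hR'⟩ := hA.isBounded.exists_norm_le
  set D := max (max R R') 0 with hD
  set μ' : Measure (RN N) := (volume A)⁻¹ • volume.restrict A with hμ'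
  have hμ'p : IsProbabilityMeasure μ' := ⟨by
    rw [hμ', Measure.smul_apply, Measure.restrict_apply_univ, smul_eq_mul,
      ENNReal.inv_mul_cancel hA0 hv]⟩
  have hμ'A : ∀ᵐ x ∂μ', x ∈ A := Measure.ae_smul_measure (ae_restrict_mem hA.measurableSet) _
  have hμ'D : ∀ᵐ x ∂μ', ‖x‖ ≤ D := by
    filter_upwards [hμ'A] with x hx
    exact (hR' x hx).trans ((le_max_right _ _).trans (le_max_left _ _))
  have hμ'M : μ' ≤ (volume A)⁻¹ • volume := by
    refine Measure.le_iff.2 fun s _ => ?_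
    rw [hμ', Measure.smul_apply, Measure.smul_apply, smul_eq_mul, smul_eq_mul]
    gcongr
    exact Measure.restrict_le_self
  set θ := a * volume A with hθ
  have hθ0 : θ ≠ 0 := mul_ne_zero ha0 hA0
  have hθt : θ ≠ ∞ := ENNReal.mul_ne_top ha hv
  have hθμ' : θ • μ' = a • volume.restrict A := by
    rw [hμ', smul_smul, hθ, mul_assoc, ENNReal.mul_inv_cancel hA0 hv, mul_one]
  -- From the part of `π` over `B`, carve out mass `θ` starting uniformly on `A`, normalise it to
  -- `ρ`, and take a bounded minimizer `ρ'` with the same marginals. Sharing the second marginal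
  -- keeps the targets of `ρ'` in `B`.
  have piece : ∀ B : Set (RN N), MeasurableSet B → (∀ y ∈ B, ‖y‖ ≤ R) →
      m ≤ (π.restrict (Prod.snd ⁻¹' B)).fst →
      ∃ ρ ρ' : Measure (RN N × RN N), ∃ ν' : Measure (RN N),
        θ • ρ ≤ π.restrict (Prod.snd ⁻¹' B) ∧
        ρ ∈ transportPlans μ' ν' ∧
        ρ' ∈ costMinimizers c₂ (costMinimizers c₁ (transportPlans μ' ν')) ∧
        InterpBounded (volume A)⁻¹ ρ' ∧ (∀ᵐ p ∂ρ', p.2 ∈ B) ∧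
        ∀ᵐ p ∂ρ', p.1 ∈ A ∧ ‖p.1‖ ≤ D ∧ ‖p.2‖ ≤ D := by
    intro B hB hBR hmB
    have hμ'f : IsFiniteMeasure (θ • μ') := by
      rw [hθμ']; exact isFiniteMeasure_of_le _ hle
    obtain ⟨τ, hτ, hτf⟩ := exists_le_fst_eq (π.restrict (Prod.snd ⁻¹' B)) (m := θ • μ')
      (by rw [hθμ']; exact hle.trans hmB)
    have hτ' : θ • (θ⁻¹ • τ) = τ := by
      rw [smul_smul, ENNReal.mul_inv_cancel hθ0 hθt, one_smul]
    have hfst : (θ⁻¹ • τ).map Prod.fst = μ' := by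
      rw [Measure.map_smul]
      change θ⁻¹ • τ.fst = μ'
      rw [hτf, smul_smul, ENNReal.inv_mul_cancel hθ0 hθt, one_smul]
    have hp : IsProbabilityMeasure (θ⁻¹ • τ) := ⟨by
      rw [← Set.preimage_univ (f := Prod.fst), ← Measure.map_apply measurable_fst .univ, hfst]
      exact hμ'p.measure_univ⟩
    have hτB : ∀ᵐ p ∂(θ⁻¹ • τ), p.2 ∈ B := by
      refine Measure.ae_smul_measure ?_ _
      exact (Measure.absolutelyContinuous_of_le hτ).ae_le
        (ae_restrict_mem (measurable_snd hB) : ∀ᵐ p ∂_, p ∈ Prod.snd ⁻¹' B)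
    have hν'p : IsProbabilityMeasure ((θ⁻¹ • τ).map Prod.snd) :=
      Measure.isProbabilityMeasure_map measurable_snd.aemeasurable
    have hν'B : ∀ᵐ y ∂((θ⁻¹ • τ).map Prod.snd), y ∈ B := by
      exact (ae_map_iff (p := fun y => y ∈ B) measurable_snd.aemeasurable hB).2 hτB
    have hν'D : ∀ᵐ y ∂((θ⁻¹ • τ).map Prod.snd), ‖y‖ ≤ D := by
      filter_upwards [hν'B] with y hy
      exact (hBR y hy).trans ((le_max_left _ _).trans (le_max_left _ _))
    obtain ⟨ρ', hρ', hρ'M⟩ := exists_interpBounded_secondary_minimizer hc₁ hc₂ h₁ h₂ hcross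
      (le_max_right _ _) hμ'D hν'D (ENNReal.inv_ne_top.2 hA0) hμ'M
    refine ⟨θ⁻¹ • τ, ρ', _, hτ'.le.trans hτ, ⟨hp, hfst, rfl⟩, hρ', hρ'M, ?_, ?_⟩
    · rw [← hρ'.1.1.2.2] at hν'B
      exact ae_of_ae_map measurable_snd.aemeasurable hν'B
    · rw [← hρ'.1.1.2.1] at hμ'A
      filter_upwards [ae_norm_le_of_mem_transportPlans hμ'D hν'D hρ'.1.1,
        ae_of_ae_map measurable_fst.aemeasurable hμ'A] with p hp hpA using ⟨hpA, hp.1, hp.2⟩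
  obtain ⟨ρ₁, ρ₁', ν₁, hρ₁, hρ₁p, hρ₁', hb₁, hB₁', hA₁⟩ := piece B₁ hB₁ hR₁ hm₁
  obtain ⟨ρ₂, ρ₂', ν₂, hρ₂, hρ₂p, hρ₂', hb₂, hB₂', hA₂⟩ := piece B₂ hB₂ hR₂ hm₂
  have : IsProbabilityMeasure ρ₁' := hρ₁'.1.1.1
  have : IsProbabilityMeasure ρ₂' := hρ₂'.1.1.1
  have hdS : Disjoint (Prod.snd ⁻¹' B₁ : Set (RN N × RN N)) (Prod.snd ⁻¹' B₂) := hd.preimage _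
  have hsum : θ • ρ₁ + θ • ρ₂ ≤ π :=
    (add_le_add hρ₁ hρ₂).trans (restrict_add_restrict_le_of_disjoint π (measurable_snd hB₂) hdS)
  have : IsFiniteMeasure (θ • ρ₁ + θ • ρ₂) := isFiniteMeasure_of_le _ hsum
  set r := π - (θ • ρ₁ + θ • ρ₂) with hr
  have hπr : r + (θ • ρ₁ + θ • ρ₂) = π := Measure.sub_add_cancel_of_le hsum
  have hmem₁ : (r + θ • ρ₁) + θ • ρ₂' ∈
      costMinimizers c₂ (costMinimizers c₁ (transportPlans μ ν)) := by
    rw [← hπr, ← add_assoc] at hπ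
    exact replace_mem_costMinimizers hθ0 hθt hπ (hf₁ _ hπ.1.1) hρ₂p hρ₂'
  have hmem₂ : (r + θ • ρ₂') + θ • ρ₁' ∈
      costMinimizers c₂ (costMinimizers c₁ (transportPlans μ ν)) := by
    rw [add_right_comm] at hmem₁
    exact replace_mem_costMinimizers hθ0 hθt hmem₁ (hf₁ _ hmem₁.1.1) hρ₁p hρ₁'
  -- Each replacement is absolutely continuous with respect to the new plan over its own target set,
  -- so singularity of those restrictions passes to the replacements.
  have hacB : ∀ (ρ : Measure (RN N × RN N)) (B : Set (RN N)), MeasurableSet B →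
      θ • ρ ≤ (r + θ • ρ₂') + θ • ρ₁' → (∀ᵐ p ∂ρ, p.2 ∈ B) →
      ρ ≪ ((r + θ • ρ₂') + θ • ρ₁').restrict (Prod.snd ⁻¹' B) := by
    intro ρ B hB hρ hρB
    refine Measure.AbsolutelyContinuous.mk fun s hs h0 => ?_
    rw [Measure.restrict_apply hs] at h0
    have h := le_antisymm ((hρ _).trans h0.le) zero_le
    rw [Measure.smul_apply, smul_eq_mul, mul_eq_zero, or_iff_right hθ0] at h
    rw [← measure_inter_add_sdiff s (measurable_snd hB : MeasurableSet (Prod.snd ⁻¹' B)), h,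
      zero_add]
    exact measure_mono_null (fun p hp => hp.2) (ae_iff.1 hρB)
  refine not_forall_mutuallySingular_interp hA hA0 hA₁ hA₂ hb₁ hb₂ fun t h0 t1 => ?_
  refine (mutuallySingular_map_interp hc₁.measurable hc₂.measurable h₁ h₂ hcross hmem₂
    (hf₂ _ hmem₂.1.1) (measurable_snd hB₁) (measurable_snd hB₂) hdS h0 t1).mono_ac ?_ ?_
  · exact (hacB ρ₁' B₁ hB₁ (Measure.le_add_left le_rfl) hB₁').map (measurable_interp t)
  · exact (hacB ρ₂' B₂ hB₂ (Measure.le_add_right (Measure.le_add_left le_rfl)) hB₂').map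
      (measurable_interp t)

/-- Boundedness of the target sets can be dropped. -/
lemma mutuallySingular_fst_restrict
    (hc₁ : Continuous (Function.uncurry c₁)) (hc₂ : Continuous (Function.uncurry c₂))
    (h₁ : ∀ x y, 0 ≤ c₁ x y) (h₂ : ∀ x y, 0 ≤ c₂ x y) (hcross : CrossingImproves c₁ c₂)
    (hac : μ ≪ volume) (hf₁ : ∀ η ∈ transportPlans μ ν, transportCost c₁ η ≠ ∞)
    (hf₂ : ∀ η ∈ transportPlans μ ν, transportCost c₂ η ≠ ∞)
    {π : Measure (RN N × RN N)}
    (hπ : π ∈ costMinimizers c₂ (costMinimizers c₁ (transportPlans μ ν)))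
    {B₁ B₂ : Set (RN N)} (hB₁ : MeasurableSet B₁) (hB₂ : MeasurableSet B₂)
    (hd : Disjoint B₁ B₂) :
    (π.restrict (Prod.snd ⁻¹' B₁)).fst ⟂ₘ (π.restrict (Prod.snd ⁻¹' B₂)).fst := by
  -- Cut the targets into countably many bounded shells; mutual singularity is checked shell by
  -- shell.
  set S : ℕ → Set (RN N) := fun n => {y | ⌊‖y‖⌋₊ = n} with hSdef
  have hS : ∀ n, MeasurableSet (S n) := fun n =>
    (Nat.measurable_floor.comp measurable_norm) (measurableSet_singleton n)
  have hdec : ∀ B : Set (RN N), MeasurableSet B → (π.restrict (Prod.snd ⁻¹' B)).fst =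
      Measure.sum fun n => (π.restrict (Prod.snd ⁻¹' (B ∩ S n))).fst := by
    intro B hB
    have e : (Prod.snd ⁻¹' B : Set (RN N × RN N)) = ⋃ n, Prod.snd ⁻¹' (B ∩ S n) := by
      ext p; simp [hSdef]
    rw [e, Measure.restrict_iUnion, Measure.fst, Measure.map_sum measurable_fst.aemeasurable]
    · rfl
    · intro i j hij
      refine Disjoint.preimage _ (Set.disjoint_left.2 fun y hy hy' => hij ?_)
      exact hy.2.symm.trans hy'.2
    · exact fun n => measurable_snd (hB.inter (hS n))
  rw [hdec B₁ hB₁, hdec B₂ hB₂, Measure.MutuallySingular.sum_left]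
  intro i
  rw [Measure.MutuallySingular.sum_right]
  intro j
  have hbound : ∀ n, ∀ y ∈ S n, ‖y‖ ≤ n + 1 := by
    intro n y hy
    have h := (Nat.lt_floor_add_one ‖y‖).le
    rwa [show ⌊‖y‖⌋₊ = n from hy] at h
  refine mutuallySingular_fst_restrict_of_bounded hc₁ hc₂ h₁ h₂ hcross hac hf₁ hf₂ hπ
    (R := max ((i : ℝ) + 1) ((j : ℝ) + 1))
    (hB₁.inter (hS i)) (hB₂.inter (hS j))
    (hd.mono Set.inter_subset_left Set.inter_subset_left)
    (fun y hy => (hbound i y hy.2).trans (le_max_left _ _))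
    (fun y hy => (hbound j y hy.2).trans (le_max_right _ _))

end Singular

/-! ### Plans on graphs, midpoints and uniqueness. -/

/-- If the parts of `π` over complementary target sets have mutually singular first marginals, then
`π` is concentrated on a graph. -/
lemma exists_map_of_mutuallySingular {X E : Type*} [MeasurableSpace X] [NormedAddCommGroup E]
    [MeasurableSpace E] [BorelSpace E] [SecondCountableTopology E] [CompleteSpace E]
    (π : Measure (X × E))
    (h : ∀ B : Set E, MeasurableSet B →
      (π.restrict (Prod.snd ⁻¹' B)).fst ⟂ₘ (π.restrict (Prod.snd ⁻¹' Bᶜ)).fst) :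
    ∃ T : X → E, Measurable T ∧ ∀ᵐ p ∂π, p.2 = T p.1 := by
  classical
  -- A set separating the two marginals decides almost surely, from the source alone, whether the
  -- target is in `B`.
  have hC : ∀ B : Set E, MeasurableSet B → ∃ C : Set X, MeasurableSet C ∧
      ∀ᵐ p ∂π, p.2 ∈ B ↔ p.1 ∈ C := by
    intro B hB
    obtain ⟨s, hs, hs₁, hs₂⟩ := h B hB
    rw [Measure.fst, Measure.map_apply measurable_fst hs,
      Measure.restrict_apply (measurable_fst hs)] at hs₁
    rw [Measure.fst, Measure.map_apply measurable_fst hs.compl,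
      Measure.restrict_apply (measurable_fst hs.compl)] at hs₂
    refine ⟨sᶜ, hs.compl, ?_⟩
    filter_upwards [measure_eq_zero_iff_ae_notMem.1 hs₁, measure_eq_zero_iff_ae_notMem.1 hs₂]
      with p hp₁ hp₂
    simp only [Set.mem_inter_iff, Set.mem_preimage, Set.mem_compl_iff] at hp₁ hp₂ ⊢
    tauto
  have hid : StronglyMeasurable (id : E → E) := stronglyMeasurable_id
  set q : ℕ → SimpleFunc E E := hid.approx with hq
  choose C hCm hCae using fun (n : ℕ) (v : E) =>
    hC (q n ⁻¹' {v}) ((q n).measurableSet_fiber v)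
  -- `T n` reconstructs the simple approximation `q n p.2` from `p.1`; its limit recovers the
  -- target.
  set T : ℕ → X → E := fun n x => ∑ v ∈ (q n).range, (C n v).indicator (fun _ => v) x with hT
  have hTm : ∀ n, StronglyMeasurable (T n) := fun n =>
    (Finset.measurable_sum _ fun v _ => measurable_const.indicator (hCm n v)).stronglyMeasurable
  refine ⟨fun x => limUnder atTop fun n => T n x, (StronglyMeasurable.limUnder hTm).measurable, ?_⟩
  have hall : ∀ᵐ p ∂π, ∀ n, ∀ v ∈ (q n).range, (p.2 ∈ q n ⁻¹' {v} ↔ p.1 ∈ C n v) := by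
    rw [ae_all_iff]
    intro n
    exact (Finset.eventually_all _).2 fun v _ => hCae n v
  filter_upwards [hall] with p hp
  have hTq : ∀ n, T n p.1 = q n p.2 := by
    intro n
    have : ∀ v ∈ (q n).range, (C n v).indicator (fun _ => v) p.1 =
        if q n p.2 = v then v else 0 := by
      intro v hv
      have := hp n v hv
      simp only [Set.mem_preimage, Set.mem_singleton_iff] at this
      simp only [Set.indicator_apply, this]
    rw [hT]
    simp only
    rw [Finset.sum_congr rfl this, Finset.sum_ite_eq, if_pos (by simp)]
  have hlim : Tendsto (fun n => T n p.1) atTop (𝓝 p.2) := by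
    simp_rw [hTq]
    exact hid.tendsto_approx p.2
  exact hlim.limUnder_eq.symm

section Uniqueness
variable {X Y : Type*} [MeasurableSpace X] [MeasurableSpace Y]

lemma eq_map_of_ae_eq {μ : Measure X} {ν : Measure Y} {π : Measure (X × Y)}
    (hπ : π ∈ transportPlans μ ν) {T : X → Y} (hT : Measurable T) (h : ∀ᵐ p ∂π, p.2 = T p.1) :
    π = μ.map fun x => (x, T x) := by
  have hg : Measurable fun x => (x, T x) := measurable_id.prodMk hT
  rw [← hπ.2.1, Measure.map_map hg measurable_fst]
  conv_lhs => rw [← Measure.map_id (μ := π)]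
  refine Measure.map_congr ?_
  filter_upwards [h] with p hp
  exact Prod.ext rfl hp

lemma half_add_half_mem_transportPlans {μ : Measure X} {ν : Measure Y} {π η : Measure (X × Y)}
    (hπ : π ∈ transportPlans μ ν) (hη : η ∈ transportPlans μ ν) :
    (2 : ℝ≥0∞)⁻¹ • (π + η) ∈ transportPlans μ ν := by
  refine ⟨⟨?_⟩, ?_, ?_⟩
  · have := hπ.1.measure_univ
    have := hη.1.measure_univ
    simp [*, ENNReal.inv_two_add_inv_two]
  · rw [Measure.map_smul, Measure.map_add _ _ measurable_fst, hπ.2.1, hη.2.1, smul_add, ← add_smul,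
      ENNReal.inv_two_add_inv_two, one_smul]
  · rw [Measure.map_smul, Measure.map_add _ _ measurable_snd, hπ.2.2, hη.2.2, smul_add, ← add_smul,
      ENNReal.inv_two_add_inv_two, one_smul]

lemma half_add_half_mem_costMinimizers {c : X → Y → ℝ} {S : Set (Measure (X × Y))}
    {π η : Measure (X × Y)} (hπ : π ∈ costMinimizers c S) (hη : η ∈ costMinimizers c S)
    (hS : (2 : ℝ≥0∞)⁻¹ • (π + η) ∈ S) :
    (2 : ℝ≥0∞)⁻¹ • (π + η) ∈ costMinimizers c S := by
  refine ⟨hS, fun ξ hξ => ?_⟩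
  rw [transportCost_smul, transportCost_add, le_antisymm (hη.2 π hπ.1) (hπ.2 η hη.1), mul_add,
    ← add_mul, ENNReal.inv_two_add_inv_two, one_mul]
  exact hπ.2 ξ hξ

end Uniqueness

/-! ### Finiteness of costs and conclusion. -/

section FiniteCost
variable {N : ℕ} {μ ν : Measure (RN N)}

lemma transportCost_dist_sq_ne_top (hμ : IsP2 μ) (hν : IsP2 ν) {π : Measure (RN N × RN N)}
    (hπ : π ∈ transportPlans μ ν) : transportCost (fun x y : RN N => dist x y ^ 2) π ≠ ∞ := by
  obtain ⟨_, x₀, hx₀⟩ := hμ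
  obtain ⟨_, y₀, hy₀⟩ := hν
  have : IsProbabilityMeasure π := hπ.1
  have m₁ : Measurable fun x : RN N => ENNReal.ofReal (dist x x₀ ^ 2) := by fun_prop
  have m₂ : Measurable fun y : RN N => ENNReal.ofReal (dist y y₀ ^ 2) := by fun_prop
  rw [← hπ.2.1, lintegral_map m₁ measurable_fst] at hx₀
  rw [← hπ.2.2, lintegral_map m₂ measurable_snd] at hy₀
  have hle : transportCost (fun x y : RN N => dist x y ^ 2) π ≤
      ∫⁻ p, (ENNReal.ofReal 3 * (ENNReal.ofReal (dist p.1 x₀ ^ 2) +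
        (ENNReal.ofReal (dist p.2 y₀ ^ 2) + ENNReal.ofReal (dist x₀ y₀ ^ 2)))) ∂π := by
    refine lintegral_mono fun p => ?_
    rw [← ENNReal.ofReal_add (by positivity) (by positivity),
      ← ENNReal.ofReal_add (by positivity) (by positivity), ← ENNReal.ofReal_mul (by norm_num)]
    refine ENNReal.ofReal_le_ofReal ?_
    have h := dist_triangle4 p.1 x₀ y₀ p.2
    rw [dist_comm y₀ p.2] at h
    have h' := pow_le_pow_left₀ dist_nonneg h 2
    -- This is `(a + b + c)² ≤ 3(a² + b² + c²)`, the source of the constant `3`.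
    nlinarith [sq_nonneg (dist p.1 x₀ - dist x₀ y₀), sq_nonneg (dist p.1 x₀ - dist p.2 y₀),
      sq_nonneg (dist x₀ y₀ - dist p.2 y₀)]
  refine (hle.trans_lt ?_).ne
  rw [lintegral_const_mul _ (by fun_prop), lintegral_add_left (by fun_prop),
    lintegral_add_left (by fun_prop)]
  refine ENNReal.mul_lt_top ENNReal.ofReal_lt_top
    (ENNReal.add_lt_top.2 ⟨hx₀, ENNReal.add_lt_top.2 ⟨hy₀, ?_⟩⟩)
  simp

lemma transportCost_crystallineDist_sq_ne_top (V : Finset (RN N)) (hμ : IsP2 μ) (hν : IsP2 ν)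
    {π : Measure (RN N × RN N)} (hπ : π ∈ transportPlans μ ν) :
    transportCost (fun x y : RN N => crystallineDist V x y ^ 2) π ≠ ∞ := by
  have hle : transportCost (fun x y : RN N => crystallineDist V x y ^ 2) π ≤
      ∫⁻ p, ENNReal.ofReal ((∑ v ∈ V, ‖v‖) ^ 2) * ENNReal.ofReal (dist p.1 p.2 ^ 2) ∂π := by
    refine lintegral_mono fun p => ?_
    rw [← ENNReal.ofReal_mul (by positivity), ← mul_pow, dist_eq_norm]
    exact ENNReal.ofReal_le_ofReal
      (pow_le_pow_left₀ (crystallineNorm_nonneg V _) (crystallineNorm_le_norm V _) 2)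
  refine (hle.trans_lt ?_).ne
  rw [lintegral_const_mul _ (by fun_prop)]
  exact ENNReal.mul_lt_top ENNReal.ofReal_lt_top (transportCost_dist_sq_ne_top hμ hν hπ).lt_top

/-- Every secondary minimizer is concentrated on a graph. -/
lemma exists_map_of_mem_secondaryMinimizers (V : Finset (RN N)) (hμ : IsP2 μ) (hν : IsP2 ν)
    (hac : μ ≪ volume) {π : Measure (RN N × RN N)} (hπ : π ∈ secondaryMinimizers V μ ν) :
    ∃ T : RN N → RN N, Measurable T ∧ ∀ᵐ p ∂π, p.2 = T p.1 :=
  exists_map_of_mutuallySingular π fun _ hB =>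
    mutuallySingular_fst_restrict (continuous_crystallineDist_sq V) continuous_dist_sq
      (fun _ _ => sq_nonneg _) (fun _ _ => sq_nonneg _) (crossingImproves_crystalline V) hac
      (fun _ hη => transportCost_crystallineDist_sq_ne_top V hμ hν hη)
      (fun _ hη => transportCost_dist_sq_ne_top hμ hν hη) hπ hB hB.compl disjoint_compl_right

end FiniteCost

theorem mainTheorem2 (N : ℕ) (V : Finset (RN N))
    (hV : Submodule.span ℝ (V : Set (RN N)) = ⊤)
    (μ ν : Measure (RN N)) (hμ : IsP2 μ) (hν : IsP2 ν) (hac : μ ≪ volume) :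
    ∃ π : Measure (RN N × RN N),
      secondaryMinimizers V μ ν = {π} ∧ IsInducedByMap μ π := by
  have := hμ.1
  have := hν.1
  obtain ⟨π, hπ⟩ : (secondaryMinimizers V μ ν).Nonempty :=
    secondary_minimizer_nonempty (continuous_crystallineDist_sq V) continuous_dist_sq
      (fun _ _ => sq_nonneg _) (fun _ _ => sq_nonneg _) μ ν
  refine ⟨π, Set.eq_singleton_iff_unique_mem.2 ⟨hπ, fun η hη => ?_⟩, ?_⟩
  · have hmid : (2 : ℝ≥0∞)⁻¹ • (η + π) ∈ secondaryMinimizers V μ ν :=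
      half_add_half_mem_costMinimizers hη hπ <| half_add_half_mem_costMinimizers hη.1 hπ.1 <|
        half_add_half_mem_transportPlans hη.1.1 hπ.1.1
    obtain ⟨T, hT, hae⟩ := exists_map_of_mem_secondaryMinimizers V hμ hν hac hmid
    -- The graph carrying the midpoint carries both summands, and a plan on a given graph is
    -- determined by its first marginal.
    rw [Measure.ae_ennreal_smul_measure_eq (by simp), ae_add_measure_iff] at hae
    rw [eq_map_of_ae_eq hη.1.1 hT hae.1, eq_map_of_ae_eq hπ.1.1 hT hae.2]
  · obtain ⟨T, hT, hae⟩ := exists_map_of_mem_secondaryMinimizers V hμ hν hac hπ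
    exact ⟨T, hT.aemeasurable, eq_map_of_ae_eq hπ.1.1 hT hae⟩
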